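/- \textbf{Setting.} Consider the four scale families of losses ($\sigma>0$) \[ \rho^{\rm Cauchy}_\sigma(r)=\tfrac{\sigma^2}{2}\log\!\Big(1+\tfrac{r^2}{\sigma^2}\Big),\quad \rho^{\rm Welsch}_\sigma(r)=\tfrac{\sigma^2}{2}\big(1-e^{-(r/\sigma)^2}\big),\quad \rho^{\rm TLS}_\sigma(r)=\tfrac12\min\{r^2,\sigma^2\},\quad \rho^{\rm Tukey}_\sigma(r)=\tfrac{\sigma^2}{6}\Big(1-\big(1-\tfrac{r^2}{\sigma^2}\big)_+^3\Big), \] with scores $\psi_\sigma=\rho_\sigma'$ (for TLS, $\psi_\sigma(\pm\sigma)=0$). For $a>0$ put \[ m(a)=\inf_{\sigma>0,\;0<|r|\le a\sigma}\frac{\psi_\sigma(r)}{r},\qquad K=\sup_{\sigma>0,\;r}\frac{|\psi_\sigma(r)|}{\sigma},\qquad h_{\rm prof}(a)=\frac{a\,m(a)}{2K},\qquad h_{\rm prof}=\sup_{a>0}h_{\rm prof}(a). \] Let $n$ cameras be given, all pairs being observed, let $E_b$ be a graph of corrupted camera edges on them, and let $E_0$ be the set of remaining (clean) edges. Let $\Delta_E$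 be the maximum degree of $E_b$ and $q_{\min}=\min_{ij\in E_0}|\{k: ik,jk\in E_0\}|$. Let $\mathcal T_0$ be the set of clean triangles (all three edges in $E_0$), let $\mathcal T_b$ be any set of non-clean triangles (the retained ones), and let $\mathcal T=\mathcal T_0\sqcup\mathcal T_b$. Every unordered pair of triangles of $\mathcal T$ sharing a camera edge is, with a fixed orientation $(t,u)$, a constraint with residual $z_u-z_t-g_{tu}$. Let $\mathcal C_0$ be the set of constraints with both triangles clean and $\mathcal C_b$ that of all others. There is $z^\star\in\mathbb R^{\mathcal T_0}$ with $g_{tu}=z^\star_u-z^\star_t$ on $\mathcal C_0$; the offsets on $\mathcal C_b$ are arbitrary reals. Let $\mathcal H_0=(\mathcal T_0,\mathcal C_0)$, let $B_0$ be its oriented incidence matrix, let $a_f$ be the restriction to $\mathcal T_0$ of the incidence row of $f\in\mathcal C_b$, and let $d_b=\max_{t\in\mathcal T_0}\sum_{f\in\mathcal C_b}|a_f(t)|$. Put $\|x\|_{\infty/\mathbf 1}=\min_\alpha\|x-\alpha\mathbf 1\|_\infty$, $E(z_0)=\|z_0-z^\star\|_{\infty/\mathbf 1}$, and \[ F_\sigma(z_0,z_b)=\sum_{(t,u)\in\mathcal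 C_0\sqcup\mathcal C_b}\rho_\sigma(z_u-z_t-g_{tu}),\qquad \Phi_\sigma(z_0)=\inf_{z_b\in\mathbb R^{\mathcal T_b}}F_\sigma(z_0,z_b). \] A \emph{clean-basin stationary point} at scale $\sigma$ is a $z_0$ with $0\in\partial\Phi_\sigma(z_0)$ (Clarke subdifferential) and $E(z_0)\le\frac a2\sigma$. For a loss, a number $a>0$ and $C_J=16$, the \emph{profiled recovery conclusion} is the conjunction of the following statements. \begin{enumerate} \item $\mathcal H_0$ is connected. \item With $\alpha=C_J/(q_{\min}-1)$: for every integer $d\ge1$, every real matrix $A$ with columns indexed by $\mathcal T_0$, row $\ell_1$-norms at most $2$ and column $\ell_1$-norms at most $d$, every diagonal $\Theta$ with entries in $[m(a),1]$, and every vector $s$ with $A^\top s\perp\mathbf 1$, \[ \|(B_0^\top\Theta B_0)^\dagger A^\top s\|_{\infty/\mathbf 1}\le\frac{\alpha d}{m(a)}\|s\|_\infty . \] \item $\gamma:=\alpha d_b<h_{\rm prof}(a)$. \item If $\tau\in(0,1)$, $\frac{2\gamma K}{a\,m(a)}<\tau$, $\sigma_0>0$, $\sigma_k=\sigma_0\tau^k$,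 and $z^{(k)}\in\mathbb R^{\mathcal T}$ ($k\ge0$) are vectors whose clean blocks $z_0^{(k)}$ are clean-basin stationary points at scale $\sigma_k$, then for all $k$ \[ E(z_0^{(k)})\le\frac{\gamma K}{m(a)}\sigma_k\le\frac a2\sigma_{k+1},\qquad E(z_0^{(k)})\le\frac a2\sigma_0\tau^k, \] and for every linear functional $\ell$ on $\mathbb R^{\mathcal T_0}$ with $\ell(\mathbf 1)=1$ (a choice of gauge) there is $\alpha_\infty\in\mathbb R$ with $z_t^{(k)}-\ell(z_0^{(k)})\to z_t^\star+\alpha_\infty$ for all $t\in\mathcal T_0$. \end{enumerate} \textbf{Corollary (Explicit profiled constants).} \begin{enumerate} \item The constants are: Cauchy $m(a)=\frac1{1+a^2}$, $K=\frac12$; Welsch $m(a)=e^{-a^2}$, $K=\frac1{\sqrt{2e}}$; TLS $m(a)=1$ for $0<a<1$, $K=1$; Tukey $m(a)=(1-a^2)^2$ for $0<a<1$, $K=\frac{16}{25\sqrt5}$. \item For each of the four losses $h_{\rm prof}=\frac12$, and with $C_J=16$ the small-gain threshold is $\frac{h_{\rm prof}}{6C_J+2h_{\rm prof}}=\frac1{194}$.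 \item For each of the four losses there are $a>0$ with $\frac{h_{\rm prof}(a)}{6C_J+2h_{\rm prof}(a)}>\frac1{200}$, and for every such $a$ there is $N$ such that for all $n\ge N$ and all data as above, $\frac{\Delta_E}{n}<\frac1{200}$ implies the profiled recovery conclusion; in particular, so does $\Delta_E\le10^{-3}n$. \item In particular, 3 holds (with the same $N$) for the problem measured from cameras: distinct $x_1,\dots,x_n\in\mathbb R^3$; unit directions $d_{ij}=-d_{ji}$; $ij\in E_b$ iff $d_{ij}\ne\frac{x_i-x_j}{\|x_i-x_j\|}$; no clean triangle collinear; $h_{t,pq}=\|d_{qr}\times d_{rp}\|$ for $t=\{p,q,r\}$; $\mathcal T_b$ the set of non-clean triangles with all three $h_{t,e}>0$; $g_{tu}=\log(h_{t,e}/h_{u,e})$ for $e=t\cap u$; and $e^{z^\star_t}$ the factor that turns the $h_{t,e}$ into the true side lengths of the clean triangle $t$. \end{enumerate} -/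

import Mathlib

namespace TriP

noncomputable section

/-! ### The four normalized redescending losses and their constants -/

/-- The four loss families. -/
inductive Loss
  | cauchy
  | welsch
  | hardThreshold
  | tukey

/-- The loss `ρ_σ(r)` at scale `σ`. The Tukey biweight is
`(σ² / 6) (1 - ((1 - (r/σ)²)₊)³)`, whose score is `r ((1 - (r/σ)²)₊)²`. -/
def Loss.rho : Loss → ℝ → ℝ → ℝ
  | .cauchy, σ, r => σ ^ 2 / 2 * Real.log (1 + r ^ 2 / σ ^ 2)
  | .welsch, σ, r => σ ^ 2 / 2 * (1 - Real.exp (-(r / σ) ^ 2))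
  | .hardThreshold, σ, r => 1 / 2 * min (r ^ 2) (σ ^ 2)
  | .tukey, σ, r => σ ^ 2 / 6 * (1 - (max (1 - (r / σ) ^ 2) 0) ^ 3)

/-- The score `ψ_σ = ρ_σ'`. The only kinks are `r = ±σ` for the hard-threshold loss;
there `deriv` is `0`, so that `ψ_σ(r) = r 1{|r| < σ}` for that loss. -/
def Loss.psi (L : Loss) (σ r : ℝ) : ℝ := deriv (L.rho σ) r

/-- The clean-window lower slope `m(a)`: the largest lower bound, over all scales `σ > 0`,
of `ψ_σ(r) / r` on `0 < |r| ≤ a σ`. -/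
def Loss.lowerSlope (L : Loss) (a : ℝ) : ℝ :=
  sInf {q | ∃ σ r : ℝ, 0 < σ ∧ r ≠ 0 ∧ |r| ≤ a * σ ∧ q = L.psi σ r / r}

/-- The maximum score `K`: the least `K` with `|ψ_σ(r)| ≤ K σ` for all `σ > 0` and `r`. -/
def Loss.maxScore (L : Loss) : ℝ :=
  sSup {q | ∃ σ r : ℝ, 0 < σ ∧ q = |L.psi σ r| / σ}

/-- `h_prof(a) = a m(a) / (2 K)`. -/
def Loss.hProfAt (L : Loss) (a : ℝ) : ℝ := a * L.lowerSlope a / (2 * L.maxScore)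

/-- `h_prof = sup_{a > 0} h_prof(a)`. -/
def Loss.hProf (L : Loss) : ℝ := sSup (L.hProfAt '' Set.Ioi 0)

/-- The small-gain threshold `h / (6 C_J + 2 h)`. -/
def smallGainThreshold (CJ h : ℝ) : ℝ := h / (6 * CJ + 2 * h)

/-! ### General analytic notions -/

/-- The Clarke subdifferential of a (locally Lipschitz) function on a finite-dimensional space:
the convex hull of all limits of derivatives along sequences of points of differentiability. -/
def clarkeSubdifferential {E : Type*} [NormedAddCommGroup E] [NormedSpace ℝ E]
    (f : E → ℝ) (x : E) : Set (E →L[ℝ] ℝ) :=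
  convexHull ℝ {ξ | ∃ u : ℕ → E, Filter.Tendsto u Filter.atTop (nhds x) ∧
    (∀ k, DifferentiableAt ℝ f (u k)) ∧
    Filter.Tendsto (fun k => fderiv ℝ f (u k)) Filter.atTop (nhds ξ)}

/-- The gauge seminorm `min_α ‖x - α 𝟏‖_∞`. -/
def gaugeNorm {ι : Type*} [Fintype ι] (x : ι → ℝ) : ℝ := ⨅ α : ℝ, ‖x - fun _ => α‖

/-- The four Penrose equations, for a square real matrix. -/
def IsPenroseInverse {ι : Type*} [Fintype ι] (M X : Matrix ι ι ℝ) : Prop :=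
  M * X * M = M ∧ X * M * X = X ∧ (M * X).transpose = M * X ∧ (X * M).transpose = X * M

open Classical in
/-- The Moore–Penrose pseudoinverse `M†`, the unique solution of the Penrose equations. -/
def pinv {ι : Type*} [Fintype ι] (M : Matrix ι ι ℝ) : Matrix ι ι ℝ :=
  if h : ∃ X, IsPenroseInverse M X then h.choose else 0

/-! ### The full all-triangle log-scale model on the complete camera graph -/

/-- Data of the log-scale synchronization problem on the cameras `Fin n`, all pairs of which
are observed. A triangle is a `3`-element set of cameras. -/
structure SyncProblem (n : ℕ) where
  /-- the graph `E_b` of corrupted camera edges -/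
  bad : SimpleGraph (Fin n)
  /-- the retained non-clean triangles `𝒯_b` -/
  nuis : Finset (Finset (Fin n))
  /-- the true log-scales `z⋆` (only the values on clean triangles matter) -/
  zstar : Finset (Fin n) → ℝ
  /-- the offset `g_{tu}` measured for `z_u - z_t` -/
  off : Finset (Fin n) → Finset (Fin n) → ℝ

/-- Two different triangles share a camera edge iff they have two cameras in common. -/
def SharesEdge {n : ℕ} (t u : Finset (Fin n)) : Prop := (t ∩ u).card = 2

namespace SyncProblem

variable {n : ℕ} (P : SyncProblem n)

open Classical in
/-- The set `𝒯₀` of clean triangles: all three camera edges are clean. -/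
def clean : Finset (Finset (Fin n)) :=
  Finset.univ.filter fun t => t.card = 3 ∧ ∀ i ∈ t, ∀ j ∈ t, ¬ P.bad.Adj i j

/-- The retained non-clean triangles are non-clean triangles, and the clean-clean constraints
are exact. Offsets of all other constraints are arbitrary. -/
def Valid : Prop :=
  (∀ t ∈ P.nuis, t.card = 3 ∧ t ∉ P.clean) ∧
  ∀ t ∈ P.clean, ∀ u ∈ P.clean, SharesEdge t u → P.off t u = P.zstar u - P.zstar t

open Classical in
/-- `Δ_E`, the maximum corrupted degree. -/
def maxBadDegree : ℕ := P.bad.maxDegree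

/-- `q_min`, the minimum over clean camera edges `ij` of the number of clean witnesses. -/
def qmin : ℕ :=
  sInf {q | ∃ i j, P.badᶜ.Adj i j ∧ q = {k | P.badᶜ.Adj i k ∧ P.badᶜ.Adj j k}.ncard}

/-- The variables: clean triangles (left) and retained non-clean triangles (right). -/
abbrev Var : Type := ↥P.clean ⊕ ↥P.nuis

/-- The triangle of a variable. -/
def tri : P.Var → Finset (Fin n) := Sum.elim Subtype.val Subtype.val

/-- Clean-clean constraints `𝒞₀`: each unordered pair of clean triangles that share an edge
occurs once, oriented by the colexicographic order. -/
def CleanCon : Type :=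
  {c : ↥P.clean × ↥P.clean // SharesEdge c.1.1 c.2.1 ∧ toColex c.1.1 < toColex c.2.1}

/-- The remaining shared-edge constraints `𝒞_b`: at least one endpoint is non-clean. -/
def BadCon : Type :=
  {f : P.Var × P.Var // SharesEdge (P.tri f.1) (P.tri f.2) ∧
    toColex (P.tri f.1) < toColex (P.tri f.2) ∧ ¬ (f.1.isLeft = true ∧ f.2.isLeft = true)}

instance : Finite P.CleanCon := by unfold CleanCon; infer_instance
instance : Finite P.BadCon := by unfold BadCon; infer_instance
instance : Fintype P.CleanCon := Fintype.ofFinite _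
instance : Fintype P.BadCon := Fintype.ofFinite _

/-- The clean triangle-overlap graph `ℋ₀`. -/
def overlapGraph : SimpleGraph ↥P.clean where
  Adj t u := t ≠ u ∧ SharesEdge t.1 u.1
  symm := ⟨fun t u h => ⟨h.1.symm, by have := h.2; unfold SharesEdge at *; rwa [Finset.inter_comm]⟩⟩
  loopless := ⟨fun _ h => h.1 rfl⟩

open Classical in
/-- The oriented incidence matrix `B₀` of the clean triangle-overlap graph. -/
def B0 : Matrix P.CleanCon ↥P.clean ℝ := fun c t =>
  (if c.1.2 = t then 1 else 0) - (if c.1.1 = t then 1 else 0)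

open Classical in
/-- The clean block `A` of the bad incidence rows. -/
def badRow : Matrix P.BadCon ↥P.clean ℝ := fun f t =>
  (if f.1.2 = Sum.inl t then 1 else 0) - (if f.1.1 = Sum.inl t then 1 else 0)

/-- The clean-boundary bad degree `d_b`, the maximum over clean triangles `t` of
`∑_{f ∈ 𝒞_b} |a_f(t)|`. -/
def cleanBoundaryBadDegree : ℝ := ⨆ t : ↥P.clean, ∑ f, |P.badRow f t|

/-- The full robust objective `F_σ(z₀, z_b)`. -/
def objective (L : Loss) (σ : ℝ) (z0 : ↥P.clean → ℝ) (zb : ↥P.nuis → ℝ) : ℝ :=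
  (∑ c : P.CleanCon, L.rho σ (z0 c.1.2 - z0 c.1.1 - P.off c.1.1.1 c.1.2.1)) +
  ∑ f : P.BadCon, L.rho σ
    (Sum.elim z0 zb f.1.2 - Sum.elim z0 zb f.1.1 - P.off (P.tri f.1.1) (P.tri f.1.2))

/-- The profiled objective `Φ_σ(z₀) = inf_{z_b} F_σ(z₀, z_b)`. -/
def profiled (L : Loss) (σ : ℝ) (z0 : ↥P.clean → ℝ) : ℝ :=
  ⨅ zb : ↥P.nuis → ℝ, P.objective L σ z0 zb

/-- The gauge-invariant clean-block error `E(z₀) = min_α ‖z₀ - z₀⋆ - α 𝟏‖_∞`. -/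
def err (z0 : ↥P.clean → ℝ) : ℝ := gaugeNorm fun t => z0 t - P.zstar t.1

/-- Clean-basin stationary point of the profiled objective at scale `σ`. -/
def CleanBasinStationary (L : Loss) (a σ : ℝ) (z0 : ↥P.clean → ℝ) : Prop :=
  0 ∈ clarkeSubdifferential (P.profiled L σ) z0 ∧ P.err z0 ≤ a / 2 * σ

open Classical in
/-- The number `α` is a weighted clean Green response constant `α_Δ(d)`
for clean weights in `[m₀, 1]`. -/
def IsGreenResponse (m0 : ℝ) (d : ℕ) (α : ℝ) : Prop :=
  ∀ (r : ℕ) (A : Matrix (Fin r) ↥P.clean ℝ) (θ : P.CleanCon → ℝ) (s : Fin r → ℝ),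
    (∀ f, ∑ t, |A f t| ≤ 2) → (∀ t, ∑ f, |A f t| ≤ d) →
    (∀ c, m0 ≤ θ c ∧ θ c ≤ 1) →
    ∑ t, (A.transpose.mulVec s) t = 0 →
    gaugeNorm ((pinv (P.B0.transpose * Matrix.diagonal θ * P.B0)).mulVec
      (A.transpose.mulVec s)) ≤ α * d / m0 * ‖s‖

/-- The conclusion of the profiled theory for the loss `L`, the window parameter `a` and the
Green response constant `α_Δ(d) = C_J / (q_min - 1)`. -/
def ProfiledRecovery (L : Loss) (a CJ : ℝ) : Prop :=
  let α : ℝ := CJ / ((P.qmin : ℝ) - 1)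
  let γ : ℝ := α * P.cleanBoundaryBadDegree
  let m : ℝ := L.lowerSlope a
  let K : ℝ := L.maxScore
  P.overlapGraph.Connected ∧
  (∀ d : ℕ, 1 ≤ d → P.IsGreenResponse m d α) ∧
  γ < L.hProfAt a ∧
  ∀ τ σ0 : ℝ, 0 < τ → 2 * γ * K / (a * m) < τ → τ < 1 → 0 < σ0 →
    ∀ z : ℕ → P.Var → ℝ,
      (∀ k, P.CleanBasinStationary L a (σ0 * τ ^ k) fun t => z k (Sum.inl t)) →
      (∀ k, P.err (fun t => z k (Sum.inl t)) ≤ γ * K / m * (σ0 * τ ^ k) ∧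
        γ * K / m * (σ0 * τ ^ k) ≤ a / 2 * (σ0 * τ ^ (k + 1)) ∧
        P.err (fun t => z k (Sum.inl t)) ≤ a / 2 * σ0 * τ ^ k) ∧
      -- convergence after fixing any consistent additive gauge
      ∀ ℓ : (↥P.clean → ℝ) →ₗ[ℝ] ℝ, ℓ (fun _ => 1) = 1 →
        ∃ αinf : ℝ, ∀ t : ↥P.clean,
          Filter.Tendsto (fun k => z k (Sum.inl t) - ℓ (fun u => z k (Sum.inl u)))
            Filter.atTop (nhds (P.zstar t.1 + αinf))

end SyncProblem

/-! ### The synchronization problem measured from camera directions -/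

/-- Camera locations and measured directions for all ordered pairs of cameras. -/
structure CameraData (n : ℕ) where
  /-- true locations -/
  loc : Fin n → EuclideanSpace ℝ (Fin 3)
  /-- measured directions -/
  dir : Fin n → Fin n → EuclideanSpace ℝ (Fin 3)

namespace CameraData

variable {n : ℕ} (C : CameraData n)

/-- The true direction. -/
def trueDir (i j : Fin n) : EuclideanSpace ℝ (Fin 3) :=
  ‖C.loc i - C.loc j‖⁻¹ • (C.loc i - C.loc j)

/-- The corrupted edges: the measured direction differs from the true one. -/
def bad : SimpleGraph (Fin n) := SimpleGraph.fromRel fun i j => C.dir i j ≠ C.trueDir i j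

/-- The side ratio `h_{t,e}` of the edge `e = {p, q}` in `t = {p, q, r}`, namely
`‖d_{qr} × d_{rp}‖`. For `e ⊆ t` the sum has exactly one term. -/
def sideRatio (t e : Finset (Fin n)) : ℝ :=
  ∑ r ∈ t \ e, ∑ p ∈ e, ∑ q ∈ e with p < q,
    ‖WithLp.toLp 2 (crossProduct (C.dir q r).ofLp (C.dir r p).ofLp)‖

/-- The sum of the true side lengths. -/
def perimeter (t : Finset (Fin n)) : ℝ :=
  ∑ p ∈ t, ∑ q ∈ t with p < q, ‖C.loc p - C.loc q‖

open Classical in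
/-- The measured log-scale synchronization problem. The offset of a shared-edge pair is
`log (h_{t,e} / h_{u,e})`; the true scale of a clean triangle is the factor that turns its side
ratios into its true side lengths; all nondegenerate non-clean triangles are retained. -/
def toSync : SyncProblem n where
  bad := C.bad
  nuis := Finset.univ.filter fun t => t.card = 3 ∧
    (∃ i ∈ t, ∃ j ∈ t, C.bad.Adj i j) ∧ ∀ e ∈ t.powersetCard 2, 0 < C.sideRatio t e
  zstar t := Real.log (C.perimeter t / ∑ e ∈ t.powersetCard 2, C.sideRatio t e)
  off t u := Real.log (C.sideRatio t (t ∩ u) / C.sideRatio u (t ∩ u))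

/-- Distinct locations, antisymmetric unit directions, and nondegenerate clean triangles. -/
def Valid : Prop :=
  Function.Injective C.loc ∧
  (∀ i j, i ≠ j → ‖C.dir i j‖ = 1 ∧ C.dir j i = -C.dir i j) ∧
  ∀ t ∈ C.toSync.clean, ¬ Collinear ℝ (C.loc '' (t : Set (Fin n)))

end CameraData

end

end TriP

namespace TriP

noncomputable section

open Filter Topology

/-! Every score has the form ψ_σ(r) = r · w(r/σ) with an even weight `w`, decreasing in |y|, with
w(0) = 1. Hence m(a) = w(a), K = sup y·w(y), and h_prof(a) = a·w(a)/(2K) has supremum 1/2 whatever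
the loss. A window with h_prof(a) > 16/33 is so close to optimal that w(a) ≥ 1/4.

The combinatorial core is an oscillation bound for the weighted clean Laplacian: if |L_θ x| ≤ D
pointwise and θ takes values in [m₀, 1] with m₀ ≥ 1/4, then osc x ≤ (32/n)·D/m₀
(`sub_le_of_abs_laplacian_le`). Let `t` be a maximum point of `x`. Summing L_θ x over the triangles
that see `t` and meet it in at least k + 1 cameras bounds the drops of `x` at level `k` by those at
the higher levels. Three such steps reach the triangles disjoint from `t`, with total drop at most
(3/2)n²D/m₀. The same holds at a minimum point, and at least (3/32)n³ triangles are counted from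
both ends, so averaging over them bounds the oscillation. With D = 0 this gives connectedness of ℋ₀
and the kernel of L_θ. In general it gives the Green response with C_J = 16, because the gauge norm
is half the oscillation and q_min - 1 ≤ n.

Next, d_b ≤ 6Δ and q_min ≥ n - 2 - 2Δ, so for Δ ≤ n/200 the gain γ is at most about 0.48/0.99 =
16/33, which is below h_prof(a) once `n` is large.

For recovery, Φ_σ minus the clean objective is an infimum of functions Lipschitz in each coordinate
`t`, with constant Kσ·∑|a_f(t)|. So Clarke stationarity forces the clean gradient to be at most
Kσ·d_b in each entry. That gradient equals L_θ(z - z⋆) with θ = w(residual/σ) in [m(a), 1], and the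
oscillation bound yields E ≤ γKσ/m(a). For camera data, the law of sines makes the clean offsets
exact differences of true log-scales. -/

/-! ### The losses through their weight functions -/

/-- The weight `ψ_1(y) / y` of a loss. -/
def Loss.weight : Loss → ℝ → ℝ
  | .cauchy, y => 1 / (1 + y ^ 2)
  | .welsch, y => Real.exp (-y ^ 2)
  | .hardThreshold, y => if |y| < 1 then 1 else 0
  | .tukey, y => (max (1 - y ^ 2) 0) ^ 2

/-- The least upper bound of `|y| w(y)`. -/
def Loss.peak : Loss → ℝ
  | .cauchy => 1 / 2
  | .welsch => 1 / Real.sqrt (2 * Real.exp 1)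
  | .hardThreshold => 1
  | .tukey => 16 / (25 * Real.sqrt 5)

theorem hasDerivAt_max_zero_cube (y : ℝ) :
    HasDerivAt (fun y : ℝ => (max y 0) ^ 3) (3 * (max y 0) ^ 2) y := by
  rcases lt_trichotomy y 0 with h | rfl | h
  · rw [max_eq_right h.le]
    have : (fun y : ℝ => (max y 0) ^ 3) =ᶠ[𝓝 y] fun _ => 0 := by
      filter_upwards [gt_mem_nhds h] with z hz
      rw [max_eq_right hz.le]; norm_num
    simpa using (hasDerivAt_const y (0 : ℝ)).congr_of_eventuallyEq this
  · rw [hasDerivAt_iff_tendsto_slope]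
    have hc : Tendsto (fun y : ℝ => (max y 0) ^ 2) (𝓝[≠] 0) (𝓝 (3 * (max (0 : ℝ) 0) ^ 2)) := by
      have : Continuous fun y : ℝ => (max y 0) ^ 2 := by fun_prop
      simpa using (this.tendsto 0).mono_left nhdsWithin_le_nhds
    refine hc.congr' ?_
    -- At the kink the difference quotient is itself `(max z 0) ^ 2`, which tends to 0.
    filter_upwards [self_mem_nhdsWithin] with z hz
    have hz : z ≠ 0 := hz
    simp only [slope_def_field]
    rcases le_total z 0 with h | h
    · simp [max_eq_right h]
    · rw [max_eq_left h, max_self]; field_simp; ring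
  · rw [max_eq_left h.le]
    have : (fun y : ℝ => (max y 0) ^ 3) =ᶠ[𝓝 y] fun y => y ^ 3 := by
      filter_upwards [lt_mem_nhds h] with z hz
      rw [max_eq_left hz.le]
    simpa using (hasDerivAt_pow 3 y).congr_of_eventuallyEq this

theorem Loss.hasDerivAt_cauchy {σ : ℝ} (hσ : 0 < σ) (r : ℝ) :
    HasDerivAt (Loss.cauchy.rho σ) (r * Loss.cauchy.weight (r / σ)) r := by
  have h1 : HasDerivAt (fun r : ℝ => 1 + r ^ 2 / σ ^ 2) (2 * r / σ ^ 2) r := by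
    simpa using ((hasDerivAt_pow 2 r).div_const (σ ^ 2)).const_add 1
  have h0 : 1 + r ^ 2 / σ ^ 2 ≠ 0 := by positivity
  refine ((h1.log h0).const_mul (σ ^ 2 / 2)).congr_deriv ?_
  simp only [Loss.weight]
  have h0' : σ ^ 2 + r ^ 2 ≠ 0 := by positivity
  field_simp

theorem Loss.hasDerivAt_welsch {σ : ℝ} (hσ : 0 < σ) (r : ℝ) :
    HasDerivAt (Loss.welsch.rho σ) (r * Loss.welsch.weight (r / σ)) r := by
  have h1 : HasDerivAt (fun r : ℝ => -(r / σ) ^ 2) (-(2 * (r / σ) * (1 / σ))) r := by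
    refine (((hasDerivAt_id r).div_const σ).pow 2).neg.congr_deriv ?_
    simp
  refine ((h1.exp.const_sub 1).const_mul (σ ^ 2 / 2)).congr_deriv ?_
  simp only [Loss.weight]
  field_simp

theorem Loss.hasDerivAt_tukey {σ : ℝ} (hσ : 0 < σ) (r : ℝ) :
    HasDerivAt (Loss.tukey.rho σ) (r * Loss.tukey.weight (r / σ)) r := by
  have h1 : HasDerivAt (fun r : ℝ => 1 - (r / σ) ^ 2) (-(2 * (r / σ) * (1 / σ))) r := by
    refine ((((hasDerivAt_id r).div_const σ).pow 2).const_sub 1).congr_deriv ?_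
    simp
  have h2 := (hasDerivAt_max_zero_cube (1 - (r / σ) ^ 2)).comp r h1
  refine ((h2.const_sub 1).const_mul (σ ^ 2 / 6)).congr_deriv ?_
  simp only [Loss.weight]
  field_simp
  ring

theorem Loss.hasDerivAt_hardThreshold {σ r : ℝ} (hr : |r| < σ) :
    HasDerivAt (Loss.hardThreshold.rho σ) (r * Loss.hardThreshold.weight (r / σ)) r := by
  have hσ : 0 < σ := (abs_nonneg r).trans_lt hr
  have hw : Loss.hardThreshold.weight (r / σ) = 1 := by
    simp only [Loss.weight]
    rw [abs_div, abs_of_pos hσ, if_pos ((div_lt_one hσ).2 hr)]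
  rw [hw]
  have h1 : HasDerivAt (fun r : ℝ => 1 / 2 * r ^ 2) (r * 1) r := by
    refine ((hasDerivAt_pow 2 r).const_mul (1 / 2 : ℝ)).congr_deriv ?_
    norm_num
    ring
  refine h1.congr_of_eventuallyEq ?_
  filter_upwards [continuous_abs.continuousAt.eventually (gt_mem_nhds hr)] with z hz
  simp only [Loss.rho]
  rw [min_eq_left (sq_le_sq.2 (by rw [abs_of_pos hσ]; exact le_of_lt hz))]

theorem Loss.psi_eq (L : Loss) {σ : ℝ} (hσ : 0 < σ) (r : ℝ) :
    L.psi σ r = r * L.weight (r / σ) := by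
  cases L with
  | cauchy => exact (Loss.hasDerivAt_cauchy hσ r).deriv
  | welsch => exact (Loss.hasDerivAt_welsch hσ r).deriv
  | tukey => exact (Loss.hasDerivAt_tukey hσ r).deriv
  | hardThreshold =>
    by_cases hr : |r| < σ
    · exact (Loss.hasDerivAt_hardThreshold hr).deriv
    · have hw : Loss.hardThreshold.weight (r / σ) = 0 := by
        simp only [Loss.weight]
        rw [abs_div, abs_of_pos hσ, if_neg (by rwa [div_lt_one hσ])]
      rw [hw, mul_zero]
      -- Where |r| ≥ σ the loss is at its global maximum. Fermat's rule covers the kinks too, since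
      -- `deriv` is 0 where no derivative exists.
      refine IsLocalMax.deriv_eq_zero (Eventually.of_forall fun z => ?_)
      have h2 : σ ^ 2 ≤ r ^ 2 := by
        rw [← sq_abs r]
        exact pow_le_pow_left₀ hσ.le (not_lt.1 hr) 2
      simp only [Loss.rho]
      rw [min_eq_right h2]
      gcongr
      exact min_le_right _ _

theorem Loss.weight_nonneg (L : Loss) (y : ℝ) : 0 ≤ L.weight y := by
  cases L <;> simp only [Loss.weight]
  · positivity
  · positivity
  · split_ifs <;> norm_num
  · positivity

theorem Loss.weight_zero (L : Loss) : L.weight 0 = 1 := by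
  cases L <;> simp [Loss.weight]

theorem Loss.weight_antitone (L : Loss) {x y : ℝ} (h : |x| ≤ |y|) : L.weight y ≤ L.weight x := by
  have h2 : x ^ 2 ≤ y ^ 2 := sq_le_sq.2 h
  cases L <;> simp only [Loss.weight]
  · gcongr
  · gcongr
  · split_ifs with h3 h4 h4
    · exact le_rfl
    · exact absurd (h.trans_lt h3) h4
    · norm_num
    · exact le_rfl
  · gcongr

theorem Loss.weight_le_one (L : Loss) (y : ℝ) : L.weight y ≤ 1 := by
  rw [← L.weight_zero]
  exact L.weight_antitone (by simp)

/-- The quotient ψ_σ(r)/r depends only on r/σ and decreases in its modulus, so the infimum is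
attained at the edge of the window. -/
theorem Loss.lowerSlope_eq (L : Loss) {a : ℝ} (ha : 0 < a) : L.lowerSlope a = L.weight a := by
  refine IsLeast.csInf_eq ⟨⟨1, a, one_pos, ha.ne', by rw [abs_of_pos ha, mul_one], ?_⟩, ?_⟩
  · rw [L.psi_eq one_pos, div_one]
    field_simp
  · rintro q ⟨σ, r, hσ, hr, hra, rfl⟩
    rw [L.psi_eq hσ, mul_div_assoc, mul_comm, div_mul_cancel₀ _ hr]
    refine L.weight_antitone ?_
    rw [abs_div, abs_of_pos hσ, abs_of_pos ha, div_le_iff₀ hσ]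
    exact hra

theorem Loss.peak_pos (L : Loss) : 0 < L.peak := by
  cases L <;> simp only [Loss.peak] <;> positivity

theorem Loss.mul_weight_le_peak (L : Loss) {y : ℝ} (hy : 0 ≤ y) : y * L.weight y ≤ L.peak := by
  cases L <;> simp only [Loss.weight, Loss.peak]
  · rw [mul_one_div, div_le_div_iff₀ (by positivity) (by norm_num)]
    nlinarith [sq_nonneg (y - 1)]
  · rw [le_div_iff₀ (by positivity)]
    -- Squaring removes the root and leaves 2y² ≤ exp(2y² - 1), an instance of 1 + x ≤ exp x.
    refine le_of_sq_le_sq (?_ : _ ≤ (1 : ℝ) ^ 2) zero_le_one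
    rw [mul_pow, mul_pow, Real.sq_sqrt (by positivity), ← Real.exp_nat_mul]
    have h1 : 2 * y ^ 2 ≤ Real.exp (2 * y ^ 2 - 1) := by
      linarith [Real.add_one_le_exp (2 * y ^ 2 - 1)]
    have h2 : Real.exp (2 * y ^ 2 - 1) * (Real.exp ((2 : ℕ) * -y ^ 2) * Real.exp 1) = 1 := by
      rw [← Real.exp_add, ← Real.exp_add, ← Real.exp_zero]
      congr 1
      push_cast
      ring
    have h3 : 0 < Real.exp ((2 : ℕ) * -y ^ 2) * Real.exp 1 := by positivity
    nlinarith
  · split_ifs with h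
    · rw [abs_of_nonneg hy] at h
      linarith
    · norm_num
  · rcases le_total (1 - y ^ 2) 0 with h | h
    · rw [max_eq_right h]
      simp only [ne_eq, OfNat.ofNat_ne_zero, not_false_eq_true, zero_pow, mul_zero]
      positivity
    · rw [max_eq_left h, le_div_iff₀ (by positivity)]
      have h5 : Real.sqrt 5 ^ 2 = 5 := Real.sq_sqrt (by norm_num)
      have h5' : 0 ≤ Real.sqrt 5 := Real.sqrt_nonneg 5
      have h53 : Real.sqrt 5 ≤ 2.24 := Real.sqrt_le_iff.2 (by norm_num)
      set s := Real.sqrt 5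
      have hy1 : y ≤ 1 := by nlinarith
      have hu0 : 0 ≤ y * s := by positivity
      have hu1 : y * s ≤ 2.24 := by nlinarith
      have hE : y * (1 - y ^ 2) ^ 2 * (25 * s) = (y * s) * (5 - (y * s) ^ 2) ^ 2 := by
        rw [mul_pow, h5]; ring
      rw [hE]
      generalize y * s = u at hu0 hu1
      -- With u = √5·y the claim is u(5 - u²)² ≤ 16. The difference of the two sides has a double
      -- root at the maximiser u = 1, and this cubic is the other factor.
      have hneg : u ^ 3 + 2 * u ^ 2 - 7 * u - 16 ≤ 0 := by
        nlinarith [mul_nonneg hu0 (sub_nonneg.2 hu1), mul_nonneg (mul_nonneg hu0 hu0) (sub_nonneg.2 hu1)]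
      nlinarith [mul_nonneg (sq_nonneg (u - 1)) (neg_nonneg.2 hneg)]

theorem Loss.isLUB_mul_weight (L : Loss) :
    IsLUB ((fun y => y * L.weight y) '' Set.Ioi 0) L.peak := by
  have hub : L.peak ∈ upperBounds ((fun y => y * L.weight y) '' Set.Ioi 0) := by
    rintro _ ⟨y, hy, rfl⟩
    exact L.mul_weight_le_peak (le_of_lt hy)
  have key : ∀ y : ℝ, 0 < y → y * L.weight y = L.peak →
      IsLUB ((fun y => y * L.weight y) '' Set.Ioi 0) L.peak := fun y hy h =>
    IsGreatest.isLUB ⟨⟨y, hy, h⟩, hub⟩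
  cases L with
  | cauchy => exact key 1 one_pos (by norm_num [Loss.weight, Loss.peak])
  | welsch =>
    refine key (1 / Real.sqrt 2) (by positivity) ?_
    simp only [Loss.weight, Loss.peak]
    rw [div_pow, Real.sq_sqrt (by norm_num), Real.sqrt_mul (by norm_num), one_pow,
      show -(1 / 2 : ℝ) = -(1 / 2 : ℝ) from rfl, Real.exp_neg, Real.exp_half]
    field_simp
  | tukey =>
    refine key (1 / Real.sqrt 5) (by positivity) ?_
    simp only [Loss.weight, Loss.peak]
    rw [div_pow, Real.sq_sqrt (by norm_num), max_eq_left (by norm_num)]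
    field_simp
    norm_num
  | hardThreshold =>
    -- For the hard threshold the supremum is not attained: it is approached as y increases to 1.
    refine ⟨hub, fun b hb => ?_⟩
    simp only [Loss.peak]
    refine le_of_forall_lt fun c hc => ?_
    have hm : max c 0 < 1 := max_lt hc one_pos
    have h0 : 0 ≤ max c 0 := le_max_right _ _
    have hm' : 0 < (max c 0 + 1) / 2 := by linarith
    have := hb ⟨(max c 0 + 1) / 2, hm', rfl⟩
    simp only [Loss.weight] at this
    rw [abs_of_pos hm', if_pos (by linarith)] at this
    have := le_max_left c 0
    linarith

theorem Loss.abs_psi_le (L : Loss) {σ : ℝ} (hσ : 0 < σ) (r : ℝ) : |L.psi σ r| ≤ L.peak * σ := by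
  rw [L.psi_eq hσ, abs_mul, abs_of_nonneg (L.weight_nonneg _), ← div_le_iff₀ hσ]
  have h := L.mul_weight_le_peak (abs_nonneg (r / σ))
  have h2 : L.weight (r / σ) = L.weight |r / σ| :=
    le_antisymm (L.weight_antitone (by simp)) (L.weight_antitone (by simp))
  rw [← h2, abs_div, abs_of_pos hσ] at h
  calc _ = |r| / σ * L.weight (r / σ) := by ring
    _ ≤ _ := h

theorem Loss.maxScore_eq (L : Loss) : L.maxScore = L.peak := by
  refine IsLUB.csSup_eq ⟨?_, fun b hb => L.isLUB_mul_weight.2 ?_⟩ ⟨_, 1, 0, one_pos, rfl⟩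
  · rintro q ⟨σ, r, hσ, rfl⟩
    rw [div_le_iff₀ hσ]
    exact L.abs_psi_le hσ r
  · rintro _ ⟨y, hy, rfl⟩
    refine hb ⟨1, y, one_pos, ?_⟩
    have hy : 0 < y := hy
    rw [L.psi_eq one_pos, div_one, div_one, abs_of_nonneg (mul_nonneg hy.le (L.weight_nonneg _))]

/-! ### The ratio h_prof and the admissible windows. -/

theorem Loss.hProfAt_eq (L : Loss) {a : ℝ} (ha : 0 < a) :
    L.hProfAt a = a * L.weight a / (2 * L.peak) := by
  rw [Loss.hProfAt, L.lowerSlope_eq ha, L.maxScore_eq]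

theorem Loss.isLUB_hProfAt (L : Loss) : IsLUB (L.hProfAt '' Set.Ioi 0) (1 / 2) := by
  have hK := L.peak_pos
  constructor
  · rintro _ ⟨a, ha, rfl⟩
    have ha : 0 < a := ha
    rw [L.hProfAt_eq ha, div_le_div_iff₀ (by positivity) (by norm_num)]
    linarith [L.mul_weight_le_peak ha.le]
  · intro b hb
    have : L.peak ≤ b * (2 * L.peak) := by
      refine L.isLUB_mul_weight.2 ?_
      rintro _ ⟨y, hy, rfl⟩
      have := hb ⟨y, hy, rfl⟩
      rwa [L.hProfAt_eq hy, div_le_iff₀ (by positivity)] at this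
    nlinarith

theorem Loss.hProf_eq (L : Loss) : L.hProf = 1 / 2 :=
  L.isLUB_hProfAt.csSup_eq ⟨_, 1, Set.mem_Ioi.2 one_pos, rfl⟩

theorem Loss.hProfAt_nonneg (L : Loss) {a : ℝ} (ha : 0 < a) : 0 ≤ L.hProfAt a := by
  rw [L.hProfAt_eq ha]
  have := L.weight_nonneg a
  have := L.peak_pos
  positivity

/-- Clearing denominators, h/(96 + 2h) > 1/200 reads 198h > 96. -/
theorem lt_smallGainThreshold_iff {h : ℝ} (hh : 0 ≤ h) :
    1 / 200 < smallGainThreshold 16 h ↔ 16 / 33 < h := by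
  rw [smallGainThreshold, div_lt_div_iff₀ (by norm_num) (by positivity)]
  constructor <;> intro <;> linarith

theorem Loss.exists_lt_hProfAt (L : Loss) : ∃ a : ℝ, 0 < a ∧ 16 / 33 < L.hProfAt a := by
  obtain ⟨_, ⟨a, ha, rfl⟩, h, -⟩ :=
    L.isLUB_hProfAt.exists_between (show (16 / 33 : ℝ) < 1 / 2 by norm_num)
  exact ⟨a, ha, h⟩

/-- Windows with `h_prof(a) > 16 / 33` have slope at least `1 / 4`. -/
theorem Loss.quarter_le_weight (L : Loss) {a : ℝ} (ha : 0 < a) (h : 16 / 33 < L.hProfAt a) :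
    1 / 4 ≤ L.weight a := by
  -- The hypothesis becomes a·w(a) > (32/33)K; each family contradicts it when w(a) < 1/4.
  rw [L.hProfAt_eq ha, lt_div_iff₀ (by linarith [L.peak_pos])] at h
  by_contra hw
  rw [not_le] at hw
  cases L with
  | cauchy =>
    simp only [Loss.weight, Loss.peak] at h hw
    rw [mul_one_div a, lt_div_iff₀ (by positivity)] at h
    rw [div_lt_div_iff₀ (by positivity) (by norm_num)] at hw
    nlinarith
  | welsch =>
    simp only [Loss.weight, Loss.peak] at h hw
    rw [mul_one_div, mul_div_assoc', div_lt_iff₀ (by positivity)] at h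
    have h0 : 0 < Real.exp (-a ^ 2) := Real.exp_pos _
    have h2 : (16 / 33 * 2 : ℝ) ^ 2 < (a * Real.exp (-a ^ 2) * Real.sqrt (2 * Real.exp 1)) ^ 2 :=
      pow_lt_pow_left₀ h (by norm_num) (by norm_num)
    rw [mul_pow, mul_pow, Real.sq_sqrt (by positivity)] at h2
    have h3 : a ^ 2 ≤ Real.exp (a ^ 2 - 1) := by
      linarith [Real.add_one_le_exp (a ^ 2 - 1)]
    have h4 : Real.exp (a ^ 2 - 1) * (Real.exp (-a ^ 2) * Real.exp 1) = 1 := by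
      rw [← Real.exp_add, ← Real.exp_add, ← Real.exp_zero]
      congr 1
      ring
    -- Hence (a·w)²·2e ≤ 2w < 1/2, while `h2` bounds the left side below by (32/33)².
    have h5 : a ^ 2 * (Real.exp (-a ^ 2) * Real.exp 1) ≤ 1 := by
      refine le_trans ?_ h4.le
      gcongr
    nlinarith
  | hardThreshold =>
    simp only [Loss.weight, Loss.peak] at h hw
    split_ifs at h hw <;> linarith
  | tukey =>
    simp only [Loss.weight, Loss.peak] at h hw
    have h5 : Real.sqrt 5 ^ 2 = 5 := Real.sq_sqrt (by norm_num)
    have h53 : Real.sqrt 5 ≤ 2.24 := Real.sqrt_le_iff.2 (by norm_num)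
    have hs : 0 < Real.sqrt 5 := by positivity
    have hz : 0 ≤ max (1 - a ^ 2) 0 := le_max_right _ _
    have ha1 : a < 1 := by
      by_contra h1
      rw [max_eq_right (by nlinarith)] at h
      have : 0 < 16 / 33 * (2 * (16 / (25 * Real.sqrt 5))) := by positivity
      norm_num at h
      linarith
    have : 16 / 33 * (2 * (16 / (25 * Real.sqrt 5))) = 512 / (825 * Real.sqrt 5) := by
      field_simp; norm_num
    rw [this, div_lt_iff₀ (by positivity)] at h
    set w := (max (1 - a ^ 2) 0) ^ 2
    have hw0 : 0 ≤ w := by positivity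
    nlinarith [mul_nonneg hw0 (sub_nonneg.2 ha1.le), mul_nonneg hw0 hs.le]

/-! ### Regularity of the losses. -/

theorem Loss.rho_nonneg (L : Loss) {σ : ℝ} (r : ℝ) : 0 ≤ L.rho σ r := by
  cases L <;> simp only [Loss.rho]
  · have : 0 ≤ Real.log (1 + r ^ 2 / σ ^ 2) :=
      Real.log_nonneg (by linarith [show 0 ≤ r ^ 2 / σ ^ 2 by positivity])
    positivity
  · have : Real.exp (-(r / σ) ^ 2) ≤ 1 := Real.exp_le_one_iff.2 (by nlinarith [sq_nonneg (r / σ)])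
    have : 0 ≤ 1 - Real.exp (-(r / σ) ^ 2) := by linarith
    positivity
  · have : 0 ≤ min (r ^ 2) (σ ^ 2) := le_min (sq_nonneg _) (sq_nonneg _)
    positivity
  · have h1 : max (1 - (r / σ) ^ 2) 0 ≤ 1 := max_le (by linarith [sq_nonneg (r / σ)]) zero_le_one
    have h2 : (max (1 - (r / σ) ^ 2) 0) ^ 3 ≤ 1 := pow_le_one₀ (le_max_right _ _) h1
    have : 0 ≤ 1 - (max (1 - (r / σ) ^ 2) 0) ^ 3 := by linarith
    positivity

theorem abs_sub_le_of_forall_hasDerivAt {f f' : ℝ → ℝ} {C : ℝ} (hf : ∀ r, HasDerivAt f (f' r) r)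
    (hC : ∀ r, |f' r| ≤ C) (x y : ℝ) : |f x - f y| ≤ C * |x - y| :=
  Convex.norm_image_sub_le_of_norm_hasDerivWithin_le (s := Set.univ)
    (fun r _ => (hf r).hasDerivWithinAt) (fun r _ => hC r) convex_univ trivial trivial

theorem Loss.abs_rho_sub_le (L : Loss) {σ : ℝ} (hσ : 0 < σ) (x y : ℝ) :
    |L.rho σ x - L.rho σ y| ≤ L.peak * σ * |x - y| := by
  have hb : ∀ r, |r * L.weight (r / σ)| ≤ L.peak * σ := fun r => by
    rw [← L.psi_eq hσ]
    exact L.abs_psi_le hσ r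
  cases L with
  | cauchy => exact abs_sub_le_of_forall_hasDerivAt (Loss.hasDerivAt_cauchy hσ) hb x y
  | welsch => exact abs_sub_le_of_forall_hasDerivAt (Loss.hasDerivAt_welsch hσ) hb x y
  | tukey => exact abs_sub_le_of_forall_hasDerivAt (Loss.hasDerivAt_tukey hσ) hb x y
  | hardThreshold =>
    -- The hard-threshold loss has kinks, so its Lipschitz bound comes from factoring a difference
    -- of squares of truncated moduli.
    have hm : ∀ r : ℝ, min (r ^ 2) (σ ^ 2) = (min |r| σ) ^ 2 := fun r => by
      rcases le_total |r| σ with h | h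
      · rw [min_eq_left h, sq_abs, min_eq_left (sq_le_sq.2 (by rwa [abs_of_pos hσ]))]
      · rw [min_eq_right h, min_eq_right (sq_le_sq.2 (by rwa [abs_of_pos hσ]))]
    simp only [Loss.rho, Loss.peak, hm, one_mul]
    have h1 : |min |x| σ - min |y| σ| ≤ |x - y| := by
      refine (abs_min_sub_min_le_max _ _ _ _).trans ?_
      rw [sub_self, abs_zero, max_eq_left (abs_nonneg _)]
      exact abs_abs_sub_abs_le x y
    have h2 : |min |x| σ + min |y| σ| ≤ 2 * σ := by
      rw [abs_of_nonneg (by positivity)]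
      linarith [min_le_right |x| σ, min_le_right |y| σ]
    calc _ = 1 / 2 * (|min |x| σ + min |y| σ| * |min |x| σ - min |y| σ|) := by
          rw [← abs_mul, ← mul_sub, abs_mul, abs_of_pos (by norm_num : (0 : ℝ) < 1 / 2)]
          congr 2
          ring
      _ ≤ 1 / 2 * (2 * σ * |x - y|) := by gcongr
      _ = _ := by ring

/-- Inside a window with positive weight the loss is continuously differentiable. -/
theorem Loss.eventually_hasDerivAt (L : Loss) {σ a r : ℝ} (hσ : 0 < σ)
    (hw : 0 < L.weight a) (hr : |r| ≤ a * σ) :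
    ∀ᶠ s in 𝓝 r, HasDerivAt (L.rho σ) (L.psi σ s) s := by
  simp only [L.psi_eq hσ]
  cases L with
  | cauchy => exact Eventually.of_forall (Loss.hasDerivAt_cauchy hσ)
  | welsch => exact Eventually.of_forall (Loss.hasDerivAt_welsch hσ)
  | tukey => exact Eventually.of_forall (Loss.hasDerivAt_tukey hσ)
  | hardThreshold =>
    have ha : |a| < 1 := by
      by_contra h
      simp [Loss.weight, h] at hw
    have : |r| < σ := by nlinarith [le_abs_self a]
    filter_upwards [continuous_abs.continuousAt.eventually (gt_mem_nhds this)] with z hz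
    exact Loss.hasDerivAt_hardThreshold hz

theorem Loss.continuousAt_psi (L : Loss) {σ a r : ℝ} (hσ : 0 < σ)
    (hw : 0 < L.weight a) (hr : |r| ≤ a * σ) : ContinuousAt (L.psi σ) r := by
  have he : L.psi σ = fun r => r * L.weight (r / σ) := funext (L.psi_eq hσ)
  cases L with
  | cauchy =>
    rw [he]
    simp only [Loss.weight]
    have : ∀ r : ℝ, 1 + (r / σ) ^ 2 ≠ 0 := fun r => by positivity
    fun_prop (disch := assumption)
  | welsch =>
    rw [he]
    simp only [Loss.weight]
    fun_prop
  | tukey =>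
    rw [he]
    simp only [Loss.weight]
    fun_prop
  | hardThreshold =>
    have ha : |a| < 1 := by
      by_contra h
      simp [Loss.weight, h] at hw
    have : |r| < σ := by nlinarith [le_abs_self a]
    refine continuousAt_id.congr ?_
    filter_upwards [continuous_abs.continuousAt.eventually (gt_mem_nhds this)] with z hz
    have hz : |z| < σ := hz
    rw [he]
    simp only [Loss.weight, id]
    rw [abs_div, abs_of_pos hσ, if_pos ((div_lt_one hσ).2 hz), mul_one]

end

end TriP

namespace TriP

noncomputable section

open Finset

/-! ### Cut estimates for the weighted clean Laplacian -/

namespace SyncProblem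

variable {n : ℕ} (P : SyncProblem n)

theorem mem_clean {t : Finset (Fin n)} :
    t ∈ P.clean ↔ t.card = 3 ∧ ∀ i ∈ t, ∀ j ∈ t, ¬ P.bad.Adj i j := by
  simp [clean]

theorem card_clean (t : ↥P.clean) : t.1.card = 3 := (P.mem_clean.1 t.2).1

theorem SharesEdge.symm {t u : Finset (Fin n)} (h : SharesEdge t u) : SharesEdge u t := by
  unfold SharesEdge at *
  rwa [inter_comm]

open Classical in
-- Each adjacent unordered pair is stored once, in colexicographic order, so adding both
-- orientations gives the sum over ordered adjacent pairs.
theorem sum_cleanCon (g : ↥P.clean → ↥P.clean → ℝ) :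
    ∑ c : P.CleanCon, (g c.1.1 c.1.2 + g c.1.2 c.1.1) =
      ∑ i, ∑ j, if SharesEdge i.1 j.1 then g i j else 0 := by
  have h1 : ∀ f : ↥P.clean → ↥P.clean → ℝ, ∑ c : P.CleanCon, f c.1.1 c.1.2 =
      ∑ i, ∑ j, if SharesEdge i.1 j.1 ∧ toColex i.1 < toColex j.1 then f i j else 0 := by
    intro f
    rw [← Fintype.sum_prod_type'
      (f := fun i j => if SharesEdge i.1 j.1 ∧ toColex i.1 < toColex j.1 then f i j else 0),
      ← sum_filter]
    exact (sum_subtype _ (fun p => by simp) fun p : ↥P.clean × ↥P.clean => f p.1 p.2).symm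
  rw [sum_add_distrib, h1 g, h1 fun i j => g j i]
  rw [sum_comm (f := fun i j : ↥P.clean =>
    if SharesEdge i.1 j.1 ∧ toColex i.1 < toColex j.1 then g j i else 0), ← sum_add_distrib]
  refine sum_congr rfl fun i _ => ?_
  rw [← sum_add_distrib]
  refine sum_congr rfl fun j _ => ?_
  have hs : SharesEdge j.1 i.1 ↔ SharesEdge i.1 j.1 := ⟨SharesEdge.symm, SharesEdge.symm⟩
  rw [hs]
  by_cases h : SharesEdge i.1 j.1
  · have hne : toColex i.1 ≠ toColex j.1 := by
      intro he
      have he : i.1 = j.1 := he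
      have := P.card_clean i
      unfold SharesEdge at h
      rw [← he, inter_self] at h
      omega
    rcases lt_or_gt_of_ne hne with hl | hl
    · simp [h, hl, hl.not_gt]
    · simp [h, hl, hl.not_gt]
  · simp [h]

theorem B0_mulVec (x : ↥P.clean → ℝ) (c : P.CleanCon) :
    P.B0.mulVec x c = x c.1.2 - x c.1.1 := by
  simp [Matrix.mulVec, dotProduct, B0, sub_mul, sum_sub_distrib]

open Classical in
/-- The weighted clean Laplacian. -/
def laplacian (θ : P.CleanCon → ℝ) : Matrix ↥P.clean ↥P.clean ℝ :=
  P.B0.transpose * Matrix.diagonal θ * P.B0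

/-- Summation by parts. Indicators as `w` give fluxes through cuts, point masses give single
entries, and constants give zero total. -/
theorem sum_mul_laplacian (θ : P.CleanCon → ℝ) (w x : ↥P.clean → ℝ) :
    ∑ t, w t * (P.laplacian θ).mulVec x t =
      ∑ c, θ c * (w c.1.2 - w c.1.1) * (x c.1.2 - x c.1.1) := by
  classical
  change w ⬝ᵥ (P.laplacian θ).mulVec x = _
  rw [laplacian, ← Matrix.mulVec_mulVec, ← Matrix.mulVec_mulVec, Matrix.dotProduct_mulVec,
    Matrix.vecMul_transpose]
  refine sum_congr rfl fun c _ => ?_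
  rw [Matrix.mulVec_diagonal, B0_mulVec, B0_mulVec]
  ring

open Classical in
/-- Flow across the boundary of a set of clean triangles, with `M - x ≥ 0`. -/
theorem sum_boundary_le {θ : P.CleanCon → ℝ} {x : ↥P.clean → ℝ} {m₀ M D : ℝ}
    (hθ : ∀ c, m₀ ≤ θ c ∧ θ c ≤ 1) (hx : ∀ t, x t ≤ M)
    (hb : ∀ t, |(P.laplacian θ).mulVec x t| ≤ D) (S : Finset ↥P.clean) :
    ∑ i ∈ S, ∑ j with j ∉ S ∧ SharesEdge i.1 j.1, (m₀ * (M - x j) - (M - x i)) ≤ S.card * D := by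
  let g : ↥P.clean → ↥P.clean → ℝ := fun i j =>
    if i ∈ S ∧ j ∉ S then m₀ * (M - x j) - (M - x i) else 0
  have hg : ∑ i ∈ S, ∑ j with j ∉ S ∧ SharesEdge i.1 j.1, (m₀ * (M - x j) - (M - x i)) =
      ∑ i, ∑ j, if SharesEdge i.1 j.1 then g i j else 0 := by
    rw [← sum_filter_add_sum_filter_not univ (· ∈ S), filter_mem_eq_inter, univ_inter,
      sum_eq_zero (s := univ.filter (· ∉ S)), add_zero]
    · refine sum_congr rfl fun i hi => ?_
      rw [sum_filter]
      refine sum_congr rfl fun j _ => ?_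
      by_cases h1 : j ∈ S <;> by_cases h2 : SharesEdge i.1 j.1 <;> simp [g, hi, h1, h2]
    · intro i hi
      have hi : i ∉ S := by simpa using hi
      simp [g, hi]
  rw [hg, ← P.sum_cleanCon]
  -- Testing against the indicator of `S` cancels every constraint that does not cross its boundary.
  have hw := P.sum_mul_laplacian θ (fun t => if t ∈ S then 1 else 0) x
  have hle : ∑ t, (if t ∈ S then (1 : ℝ) else 0) * (P.laplacian θ).mulVec x t ≤ S.card * D := by
    simp only [ite_mul, one_mul, zero_mul]
    rw [← sum_filter, filter_mem_eq_inter, univ_inter, ← nsmul_eq_mul]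
    exact sum_le_card_nsmul _ _ _ fun t _ => (le_abs_self _).trans (hb t)
  refine le_trans (sum_le_sum fun c _ => ?_) (hw ▸ hle)
  have h1 := hx c.1.1
  have h2 := hx c.1.2
  obtain ⟨h3, h4⟩ := hθ c
  -- For a crossing constraint from `i` inside to `j` outside, the flow θ((M - x j) - (M - x i)) is
  -- at least m₀(M - x j) - (M - x i), by both bounds on θ.
  by_cases ha : c.1.1 ∈ S <;> by_cases hb : c.1.2 ∈ S <;> simp [g, ha, hb] <;>
    nlinarith

/-! ### Triangles that see a fixed triangle cleanly -/

open Classical in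
/-- The cameras with a corrupted edge to `i`. -/
def badNbrs (i : Fin n) : Finset (Fin n) := univ.filter fun j => P.bad.Adj i j

theorem mem_badNbrs {i j : Fin n} : j ∈ P.badNbrs i ↔ P.bad.Adj i j := by simp [badNbrs]

theorem card_badNbrs_le (i : Fin n) : (P.badNbrs i).card ≤ P.maxBadDegree := by
  classical
  have h := P.bad.degree_le_maxDegree i
  rw [← SimpleGraph.card_neighborFinset_eq_degree] at h
  unfold maxBadDegree
  convert h using 2
  ext j
  simp [mem_badNbrs]

/-- The cameras with a corrupted edge to `t`. -/
def badStar (t : Finset (Fin n)) : Finset (Fin n) := t.biUnion P.badNbrs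

theorem mem_badStar {t : Finset (Fin n)} {j : Fin n} :
    j ∈ P.badStar t ↔ ∃ i ∈ t, P.bad.Adj i j := by simp [badStar, mem_badNbrs]

theorem card_badStar_le (t : Finset (Fin n)) : (P.badStar t).card ≤ t.card * P.maxBadDegree :=
  card_biUnion_le_card_mul _ _ _ fun i _ => P.card_badNbrs_le i

/-- No corrupted edge joins `i` and `t`. -/
def Sees (t i : Finset (Fin n)) : Prop := ∀ x ∈ i, x ∉ P.badStar t

open Classical in
/-- The clean triangles that see `t` and have at least `k` cameras in common with it. -/
def near (t : Finset (Fin n)) (k : ℕ) : Finset ↥P.clean :=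
  univ.filter fun i => P.Sees t i.1 ∧ k ≤ (i.1 ∩ t).card

open Classical in
/-- The clean triangles that see `t` and have exactly `k` cameras in common with it. -/
def level (t : Finset (Fin n)) (k : ℕ) : Finset ↥P.clean :=
  univ.filter fun i => P.Sees t i.1 ∧ (i.1 ∩ t).card = k

theorem mem_near {t : Finset (Fin n)} {k : ℕ} {i : ↥P.clean} :
    i ∈ P.near t k ↔ P.Sees t i.1 ∧ k ≤ (i.1 ∩ t).card := by simp [near]

theorem mem_level {t : Finset (Fin n)} {k : ℕ} {i : ↥P.clean} :
    i ∈ P.level t k ↔ P.Sees t i.1 ∧ (i.1 ∩ t).card = k := by simp [level]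

theorem exists_eq_insert_erase {i j : Finset (Fin n)} (hi : i.card = 3) (hj : j.card = 3)
    (h : SharesEdge i j) : ∃ w ∈ i, ∃ z, z ∉ i ∧ w ∉ j ∧ j = insert z (i.erase w) := by
  have h1 : (i \ j).card = 1 := by have := card_sdiff_add_card_inter i j; unfold SharesEdge at h; omega
  have h2 : (j \ i).card = 1 := by
    have := card_sdiff_add_card_inter j i
    rw [inter_comm] at this
    unfold SharesEdge at h
    omega
  obtain ⟨w, hw⟩ := card_eq_one.1 h1
  obtain ⟨z, hz⟩ := card_eq_one.1 h2
  have hw' : ∀ y, (y ∈ i ∧ y ∉ j) ↔ y = w := fun y => by rw [← mem_sdiff, hw, mem_singleton]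
  have hz' : ∀ y, (y ∈ j ∧ y ∉ i) ↔ y = z := fun y => by rw [← mem_sdiff, hz, mem_singleton]
  refine ⟨w, ((hw' w).2 rfl).1, z, ((hz' z).2 rfl).2, ((hw' w).2 rfl).2, ?_⟩
  ext y
  rw [mem_insert, mem_erase]
  have h3 := hw' y
  have h4 := hz' y
  have h5 := ((hw' w).2 rfl)
  have h6 := ((hz' z).2 rfl)
  constructor
  · intro hy
    by_cases hyi : y ∈ i
    · refine Or.inr ⟨?_, hyi⟩
      rintro rfl
      exact h5.2 hy
    · exact Or.inl (h4.1 ⟨hy, hyi⟩)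
  · rintro (rfl | ⟨hyw, hyi⟩)
    · exact h6.1
    · by_contra hyj
      exact hyw (h3.1 ⟨hyi, hyj⟩)

theorem sharesEdge_insert_erase {j : Finset (Fin n)} (hj : j.card = 3) {a x : Fin n} (ha : a ∉ j)
    (hx : x ∈ j) : SharesEdge (insert a (j.erase x)) j := by
  unfold SharesEdge
  rw [insert_inter_of_notMem ha, inter_eq_left.2 (erase_subset _ _), card_erase_of_mem hx, hj]

theorem card_insert_erase {j : Finset (Fin n)} (hj : j.card = 3) {a x : Fin n} (ha : a ∉ j)
    (hx : x ∈ j) : (insert a (j.erase x)).card = 3 := by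
  rw [card_insert_of_notMem (fun h => ha (mem_of_mem_erase h)), card_erase_of_mem hx, hj]

open Classical in
-- A neighbour arises by exchanging one camera. It leaves the near set only if the removed camera
-- lies in `t`, with at most `n` replacements, or if the new camera is one of at most 3Δ with a
-- corrupted edge to `t`.
theorem card_outer_boundary_le (t : ↥P.clean) {k : ℕ} {i : ↥P.clean} (hi : i ∈ P.near t.1 k) :
    (univ.filter fun j => j ∉ P.near t.1 k ∧ SharesEdge i.1 j.1).card ≤
      (i.1 ∩ t.1).card * n + 9 * P.maxBadDegree := by
  rw [mem_near] at hi
  have hsub : (univ.filter fun j => j ∉ P.near t.1 k ∧ SharesEdge i.1 j.1).image Subtype.val ⊆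
      ((i.1 ∩ t.1) ×ˢ univ ∪ i.1 ×ˢ P.badStar t.1).image
        fun p : Fin n × Fin n => insert p.2 (i.1.erase p.1) := by
    intro u hu
    simp only [mem_image, mem_filter, mem_univ, true_and] at hu
    obtain ⟨j, ⟨hj, hij⟩, rfl⟩ := hu
    obtain ⟨w, hw, z, hz, hwj, hjz⟩ := exists_eq_insert_erase (P.card_clean i) (P.card_clean j) hij
    rw [mem_image]
    refine ⟨(w, z), ?_, hjz.symm⟩
    simp only [mem_union, mem_product, mem_inter, mem_univ, and_true]
    by_cases hzt : z ∈ P.badStar t.1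
    · exact Or.inr ⟨hw, hzt⟩
    · refine Or.inl ⟨hw, ?_⟩
      by_contra hwt
      refine hj (P.mem_near.2 ⟨?_, hi.2.trans (card_le_card ?_)⟩)
      · intro y hy
        rw [hjz, mem_insert] at hy
        rcases hy with rfl | hy
        · exact hzt
        · exact hi.1 y (mem_of_mem_erase hy)
      · intro y hy
        rw [mem_inter] at hy ⊢
        refine ⟨?_, hy.2⟩
        rw [hjz]
        exact mem_insert_of_mem (mem_erase.2 ⟨fun h => hwt (h ▸ hy.2), hy.1⟩)
  rw [← card_image_of_injective _ Subtype.val_injective]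
  refine (card_le_card hsub).trans (card_image_le.trans ((card_union_le _ _).trans ?_))
  rw [card_product, card_product, card_univ, Fintype.card_fin]
  have h1 := P.card_badStar_le t.1
  rw [P.card_clean t] at h1
  rw [P.card_clean i]
  omega

open Classical in
-- Exchange any of the 3 - k cameras of j \ t for any of the 3 - k cameras of t \ j. Since `j` sees
-- `t`, the result is still clean and sees `t`.
theorem le_card_inner_nbrs (t : ↥P.clean) {k : ℕ} {j : ↥P.clean} (hj : j ∈ P.level t.1 k) :
    (3 - k) ^ 2 ≤
      (univ.filter fun i => i ∈ P.near t.1 (k + 1) ∧ SharesEdge i.1 j.1).card := by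
  rw [mem_level] at hj
  have hjc := P.mem_clean.1 j.2
  have htc := P.mem_clean.1 t.2
  have hsub : ((t.1 \ j.1) ×ˢ (j.1 \ t.1)).image
        (fun p : Fin n × Fin n => insert p.1 (j.1.erase p.2)) ⊆
      (univ.filter fun i => i ∈ P.near t.1 (k + 1) ∧ SharesEdge i.1 j.1).image Subtype.val := by
    intro u hu
    rw [mem_image] at hu
    obtain ⟨⟨a, x⟩, hp, rfl⟩ := hu
    rw [mem_product, mem_sdiff, mem_sdiff] at hp
    obtain ⟨⟨hat, haj⟩, hxj, hxt⟩ := hp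
    have hax : ∀ y ∈ j.1, ¬ P.bad.Adj a y := fun y hy h =>
      hj.1 y hy (P.mem_badStar.2 ⟨a, hat, h⟩)
    have hcl : insert a (j.1.erase x) ∈ P.clean := by
      refine P.mem_clean.2 ⟨card_insert_erase hjc.1 haj hxj, fun y hy z hz => ?_⟩
      rw [mem_insert] at hy hz
      rcases hy with rfl | hy <;> rcases hz with rfl | hz
      · exact P.bad.loopless.irrefl _
      · exact hax z (mem_of_mem_erase hz)
      · exact fun h => hax y (mem_of_mem_erase hy) h.symm
      · exact hjc.2 y (mem_of_mem_erase hy) z (mem_of_mem_erase hz)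
    simp only [mem_image, mem_filter, mem_univ, true_and, mem_near]
    refine ⟨⟨_, hcl⟩, ⟨⟨?_, ?_⟩, sharesEdge_insert_erase hjc.1 haj hxj⟩, rfl⟩
    · intro y hy
      rw [mem_insert] at hy
      rcases hy with rfl | hy
      · rw [mem_badStar]
        rintro ⟨b, hb, h⟩
        exact htc.2 b hb _ hat h
      · exact hj.1 y (mem_of_mem_erase hy)
    · have hsub : insert a (j.1 ∩ t.1) ⊆ insert a (j.1.erase x) ∩ t.1 := by
        intro y hy
        rw [mem_insert, mem_inter] at hy
        rw [mem_inter, mem_insert, mem_erase]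
        rcases hy with rfl | hy
        · exact ⟨Or.inl rfl, hat⟩
        · exact ⟨Or.inr ⟨fun h => hxt (h ▸ hy.2), hy.1⟩, hy.2⟩
      refine le_trans (le_of_eq ?_) (card_le_card hsub)
      rw [card_insert_of_notMem (fun h => haj (mem_inter.1 h).1), hj.2]
  have hinj : Set.InjOn (fun p : Fin n × Fin n => insert p.1 (j.1.erase p.2))
      ((t.1 \ j.1) ×ˢ (j.1 \ t.1) : Finset _) := by
    rintro ⟨a, x⟩ hp ⟨b, y⟩ hq he
    simp only [coe_product, Set.mem_prod, mem_coe, mem_sdiff] at hp hq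
    simp only at he
    have h1 : a ∈ insert b (j.1.erase y) := he ▸ mem_insert_self a _
    have h2 : x ∉ insert b (j.1.erase y) := by
      rw [← he, mem_insert, mem_erase]
      rintro (rfl | h)
      · exact hp.1.2 hp.2.1
      · exact h.1 rfl
    rw [mem_insert, mem_erase] at h1 h2
    have hab : a = b := h1.resolve_right fun h => hp.1.2 h.2
    have hxy : x = y := by
      by_contra h
      exact h2 (Or.inr ⟨h, hp.2.1⟩)
    rw [hab, hxy]
  have h := card_le_card hsub
  rw [card_image_of_injOn hinj, card_product, card_image_of_injective _ Subtype.val_injective] at h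
  refine le_trans (le_of_eq ?_) h
  have h1 := card_sdiff_add_card_inter j.1 t.1
  have h2 := card_sdiff_add_card_inter t.1 j.1
  rw [inter_comm] at h2
  rw [hj.2, hjc.1] at h1
  rw [hj.2, htc.1] at h2
  rw [sq]
  congr 1 <;> omega

/-- Such a triangle is the union of `k` cameras of `t` and 3 - k further cameras. -/
theorem card_near_le (t : ↥P.clean) (k : ℕ) :
    (P.near t.1 k).card ≤ Nat.choose 3 k * Nat.choose n (3 - k) := by
  classical
  have hsub : (P.near t.1 k).image Subtype.val ⊆
      (powersetCard k t.1 ×ˢ powersetCard (3 - k) univ).image fun p => p.1 ∪ p.2 := by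
    intro u hu
    rw [mem_image] at hu
    obtain ⟨i, hi, rfl⟩ := hu
    rw [mem_near] at hi
    obtain ⟨e, he, hec⟩ := exists_subset_card_eq hi.2
    rw [mem_image]
    have hei : e ⊆ i.1 := he.trans inter_subset_left
    refine ⟨(e, i.1 \ e), ?_, union_sdiff_of_subset hei⟩
    rw [mem_product, mem_powersetCard, mem_powersetCard]
    refine ⟨⟨he.trans inter_subset_right, hec⟩, subset_univ _, ?_⟩
    rw [card_sdiff_of_subset hei, hec, P.card_clean]
  rw [← card_image_of_injective _ Subtype.val_injective]
  refine (card_le_card hsub).trans (card_image_le.trans ?_)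
  rw [card_product, card_powersetCard, card_powersetCard, P.card_clean, card_univ, Fintype.card_fin]

/-- One step of the descent away from the maximum point of `x`. -/
theorem level_sum_le {θ : P.CleanCon → ℝ} {x : ↥P.clean → ℝ} {m₀ M D : ℝ} (hm : 0 ≤ m₀)
    (hθ : ∀ c, m₀ ≤ θ c ∧ θ c ≤ 1) (hx : ∀ t, x t ≤ M)
    (hb : ∀ t, |(P.laplacian θ).mulVec x t| ≤ D) (t : ↥P.clean) {k : ℕ} :
    m₀ * (((3 - k : ℕ) : ℝ) ^ 2 * ∑ j ∈ P.level t.1 k, (M - x j)) ≤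
      (P.near t.1 (k + 1)).card * D +
        ∑ i ∈ P.near t.1 (k + 1), (M - x i) * ((i.1 ∩ t.1).card * n + 9 * P.maxBadDegree) := by
  classical
  have h := P.sum_boundary_le hθ hx hb (P.near t.1 (k + 1))
  set S := P.near t.1 (k + 1)
  simp only [sum_sub_distrib, sum_const, nsmul_eq_mul] at h
  have h1 : ∑ i ∈ S, ((univ.filter fun j => j ∉ S ∧ SharesEdge i.1 j.1).card : ℝ) * (M - x i) ≤
      ∑ i ∈ S, (M - x i) * ((i.1 ∩ t.1).card * n + 9 * P.maxBadDegree) := by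
    refine sum_le_sum fun i hi => ?_
    rw [mul_comm]
    refine mul_le_mul_of_nonneg_left ?_ (sub_nonneg.2 (hx i))
    exact_mod_cast P.card_outer_boundary_le t hi
  have h2 : m₀ * (((3 - k : ℕ) : ℝ) ^ 2 * ∑ j ∈ P.level t.1 k, (M - x j)) ≤
      ∑ i ∈ S, ∑ j with j ∉ S ∧ SharesEdge i.1 j.1, m₀ * (M - x j) := by
    have h3 : ∑ j ∈ P.level t.1 k, ∑ i with i ∈ S ∧ SharesEdge i.1 j.1, m₀ * (M - x j) ≤
        ∑ i ∈ S, ∑ j with j ∉ S ∧ SharesEdge i.1 j.1, m₀ * (M - x j) := by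
      -- Counting from outside, each level-k triangle receives at least (3 - k)² of the crossing
      -- constraints.
      rw [sum_comm' (t' := S)
        (s' := fun i => (P.level t.1 k).filter fun j => SharesEdge i.1 j.1)]
      · refine sum_le_sum fun i _ => sum_le_sum_of_subset_of_nonneg ?_ fun j _ _ =>
          mul_nonneg hm (sub_nonneg.2 (hx j))
        intro j hj
        simp only [mem_filter, mem_univ, true_and, mem_level] at hj ⊢
        refine ⟨fun hS => ?_, hj.2⟩
        have := (P.mem_near.1 hS).2
        omega
      · intro i j
        simp only [mem_filter, mem_univ, true_and]
        tauto
    refine le_trans ?_ h3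
    rw [mul_sum, mul_sum]
    refine sum_le_sum fun j hj => ?_
    rw [sum_const, nsmul_eq_mul]
    have := P.le_card_inner_nbrs t hj
    have : (((3 - k : ℕ) : ℝ)) ^ 2 ≤
        ((univ.filter fun i => i ∈ S ∧ SharesEdge i.1 j.1).card : ℝ) := by exact_mod_cast this
    have h0 := mul_nonneg hm (sub_nonneg.2 (hx j))
    nlinarith
  have h4 : ∑ i ∈ S, ((univ.filter fun j => j ∉ S ∧ SharesEdge i.1 j.1).card : ℝ) * (M - x i) =
      ∑ i ∈ S, ((univ.filter fun j => j ∉ S ∧ SharesEdge i.1 j.1).card : ℝ) * M -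
        ∑ i ∈ S, ((univ.filter fun j => j ∉ S ∧ SharesEdge i.1 j.1).card : ℝ) * x i := by
    simp only [← sum_sub_distrib, mul_sub]
  linarith

end SyncProblem

end

end TriP

namespace TriP

noncomputable section

open Finset

namespace SyncProblem

variable {n : ℕ} (P : SyncProblem n)

/-! ### Descent from an extremum and the oscillation bound. -/

theorem sum_near (t : Finset (Fin n)) (k : ℕ) (f : ↥P.clean → ℝ) :
    ∑ i ∈ P.near t k, f i = ∑ i ∈ P.level t k, f i + ∑ i ∈ P.near t (k + 1), f i := by
  classical
  rw [← sum_union]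
  · refine sum_congr (ext fun i => ?_) fun _ _ => rfl
    rw [mem_union, mem_near, mem_near, mem_level]
    have : k ≤ (i.1 ∩ t).card ↔ (i.1 ∩ t).card = k ∨ k + 1 ≤ (i.1 ∩ t).card := by omega
    tauto
  · rw [disjoint_left]
    intro i h1 h2
    rw [mem_near] at h2
    rw [mem_level] at h1
    omega

theorem sum_level_weighted (t : Finset (Fin n)) (k : ℕ) (f : ↥P.clean → ℝ) (c : ℝ) :
    ∑ i ∈ P.level t k, f i * ((i.1 ∩ t).card * n + c) =
      (k * n + c) * ∑ i ∈ P.level t k, f i := by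
  rw [mul_sum]
  refine sum_congr rfl fun i hi => ?_
  rw [(P.mem_level.1 hi).2]
  ring

theorem eq_of_mem_near_three {t i : ↥P.clean} (h : i ∈ P.near t.1 3) : i = t := by
  have h1 := (P.mem_near.1 h).2
  have h2 : i.1 ∩ t.1 = i.1 := eq_of_subset_of_card_le inter_subset_left (by rw [P.card_clean]; exact h1)
  have h3 : i.1 ∩ t.1 = t.1 := eq_of_subset_of_card_le inter_subset_right (by rw [P.card_clean]; exact h1)
  exact Subtype.ext (h2.symm.trans h3)

/-- The potential drop from a maximum point, summed over the disjoint triangles that see it. -/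
theorem sum_level_zero_le {θ : P.CleanCon → ℝ} {x : ↥P.clean → ℝ} {m₀ D : ℝ} (hm : 1 / 4 ≤ m₀)
    (hn : 1000 ≤ n) (hΔ : (P.maxBadDegree : ℝ) ≤ n / 200)
    (hθ : ∀ c, m₀ ≤ θ c ∧ θ c ≤ 1) (t : ↥P.clean) (hx : ∀ u, x u ≤ x t)
    (hb : ∀ u, |(P.laplacian θ).mulVec x u| ≤ D) :
    ∑ j ∈ P.level t.1 0, (x t - x j) ≤ 3 / 2 * n ^ 2 * (D / m₀) := by
  have hm0 : 0 < m₀ := by linarith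
  have hD : 0 ≤ D := (abs_nonneg _).trans (hb t)
  have hn' : (1000 : ℝ) ≤ n := by exact_mod_cast hn
  -- The innermost set contains at most `t` itself, whose drop is zero, so the descent starts from
  -- nothing but D.
  have hz : ∑ i ∈ P.near t.1 3, (x t - x i) * ((i.1 ∩ t.1).card * n + 9 * P.maxBadDegree) = 0 :=
    sum_eq_zero fun i hi => by rw [P.eq_of_mem_near_three hi, sub_self, zero_mul]
  have h2 := P.level_sum_le hm0.le hθ hx hb t (k := 2)
  have h1 := P.level_sum_le hm0.le hθ hx hb t (k := 1)
  have h0 := P.level_sum_le hm0.le hθ hx hb t (k := 0)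
  have c3 : ((P.near t.1 3).card : ℝ) ≤ 1 := by
    exact_mod_cast (P.card_near_le t 3).trans (by simp)
  have c2 : ((P.near t.1 2).card : ℝ) ≤ 3 * n := by
    exact_mod_cast (P.card_near_le t 2).trans (by simp [Nat.choose])
  have c1 : ((P.near t.1 1).card : ℝ) ≤ 3 / 2 * n ^ 2 := by
    have h : ((P.near t.1 1).card : ℝ) ≤ 3 * Nat.choose n 2 := by
      exact_mod_cast (P.card_near_le t 1).trans (by simp)
    rw [Nat.cast_choose_two] at h
    nlinarith
  simp only [Nat.reduceAdd, Nat.reduceSub, Nat.cast_one, Nat.cast_ofNat, zero_add, one_pow,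
    one_mul] at h0 h1 h2
  rw [hz] at h2
  rw [P.sum_near _ 2, hz, P.sum_level_weighted] at h1
  rw [P.sum_near _ 1, P.sum_near _ 2, hz, P.sum_level_weighted, P.sum_level_weighted] at h0
  have hnn : ∀ k, 0 ≤ ∑ j ∈ P.level t.1 k, (x t - x j) := fun k =>
    sum_nonneg fun j _ => sub_nonneg.2 (hx j)
  have hU1 := hnn 1
  have hU2 := hnn 2
  generalize ∑ j ∈ P.level t.1 0, (x t - x j) = U0 at *
  generalize ∑ j ∈ P.level t.1 1, (x t - x j) = U1 at *
  generalize ∑ j ∈ P.level t.1 2, (x t - x j) = U2 at *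
  obtain ⟨E, rfl⟩ : ∃ E, D = m₀ * E := ⟨D / m₀, by field_simp⟩
  have hE : 0 ≤ E := nonneg_of_mul_nonneg_right hD hm0
  rw [mul_div_cancel_left₀ _ hm0.ne']
  generalize (P.maxBadDegree : ℝ) = Δ at *
  push_cast at h0 h1 h2
  have hU2' : U2 ≤ E := by
    refine le_of_mul_le_mul_left ?_ hm0
    nlinarith
  -- Here 4·m₀·U1 ≤ 3n·m₀E + 2.045nE, with 2n + 9Δ ≤ 2.045n. Since m₀ ≥ 1/4, the last term costs a
  -- factor 4, and (3 + 8.18)/4 < 2.8.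
  have hU1' : U1 ≤ 2.8 * n * E := by
    have a1 : ((P.near t.1 2).card : ℝ) * (m₀ * E) ≤ 3 * n * (m₀ * E) :=
      mul_le_mul_of_nonneg_right c2 hD
    have a2 : (2 * n + 9 * Δ) * U2 ≤ 2.045 * n * E := by
      refine mul_le_mul (by linarith) hU2' hU2 (by positivity)
    have a3 : n * E ≤ 4 * (m₀ * (n * E)) := by
      have : 0 ≤ n * E := by positivity
      nlinarith
    refine le_of_mul_le_mul_left ?_ hm0
    nlinarith
  have a1 : ((P.near t.1 1).card : ℝ) * (m₀ * E) ≤ 3 / 2 * n ^ 2 * (m₀ * E) :=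
    mul_le_mul_of_nonneg_right c1 hD
  have a2 : (2 * n + 9 * Δ) * U2 ≤ 2.045 * n * E := by
    refine mul_le_mul (by linarith) hU2' hU2 (by positivity)
  have a3 : (1 * n + 9 * Δ) * U1 ≤ 1.045 * n * (2.8 * n * E) := by
    refine mul_le_mul (by linarith) hU1' hU1 (by positivity)
  have a4 : n ^ 2 * E ≤ 4 * (m₀ * (n ^ 2 * E)) := by
    have : 0 ≤ n ^ 2 * E := by positivity
    nlinarith
  have a5 : 1000 * (n * E) ≤ n ^ 2 * E := by
    have : 0 ≤ n * E := by positivity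
    nlinarith
  -- The coefficients add up to 1.5 + 4·1.045·2.8 + 4·2.045/1000 < 13.5 = 9·(3/2).
  refine le_of_mul_le_mul_left ?_ hm0
  nlinarith

/-- Many clean triangles lie apart from two given clean triangles and see both. -/
theorem le_card_level_inter (hn : 1000 ≤ n) (hΔ : (P.maxBadDegree : ℝ) ≤ n / 200)
    (t u : ↥P.clean) :
    3 / 32 * (n : ℝ) ^ 3 ≤ ((P.level t.1 0 ∩ P.level u.1 0).card : ℝ) := by
  classical
  -- A triple fails to be counted only if it meets `Z` or contains a corrupted edge; `B` lists these
  -- edges as ordered pairs.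
  set Z : Finset (Fin n) := (t.1 ∪ u.1) ∪ (P.badStar t.1 ∪ P.badStar u.1)
  set B : Finset (Fin n × Fin n) := univ.biUnion fun x => (P.badNbrs x).image fun y => (x, y)
  have hZ : Z.card ≤ 6 + 6 * P.maxBadDegree := by
    have h1 := P.card_badStar_le t.1
    have h2 := P.card_badStar_le u.1
    rw [P.card_clean] at h1 h2
    have h3 := P.card_clean t
    have h4 := P.card_clean u
    have := card_union_le t.1 u.1
    have := card_union_le (P.badStar t.1) (P.badStar u.1)
    have : Z.card ≤ _ := card_union_le (t.1 ∪ u.1) (P.badStar t.1 ∪ P.badStar u.1)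
    omega
  have hB : B.card ≤ n * P.maxBadDegree := by
    have := card_biUnion_le_card_mul univ (fun x => (P.badNbrs x).image fun y => (x, y)) _
      fun x _ => card_image_le.trans (P.card_badNbrs_le x)
    rwa [card_univ, Fintype.card_fin] at this
  have hsub : powersetCard 3 (univ : Finset (Fin n)) ⊆
      (P.level t.1 0 ∩ P.level u.1 0).image Subtype.val ∪
        ((Z ×ˢ (univ ×ˢ univ)).image (fun p : Fin n × Fin n × Fin n => {p.1, p.2.1, p.2.2}) ∪
          (B ×ˢ univ).image (fun p : (Fin n × Fin n) × Fin n => {p.1.1, p.1.2, p.2})) := by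
    intro s hs
    have hs3 := (mem_powersetCard.1 hs).2
    by_cases hsZ : ∃ x ∈ s, x ∈ Z
    · obtain ⟨x, hx, hxZ⟩ := hsZ
      have h2 : (s.erase x).card = 2 := by rw [card_erase_of_mem hx, hs3]
      obtain ⟨y, z, -, hyz⟩ := card_eq_two.1 h2
      refine mem_union_right _ (mem_union_left _ (mem_image.2 ⟨(x, y, z), ?_, ?_⟩))
      · simp [hxZ]
      · change insert x ({y, z} : Finset (Fin n)) = s
        rw [← hyz, insert_erase hx]
    push Not at hsZ
    by_cases hsB : ∃ x ∈ s, ∃ y ∈ s, P.bad.Adj x y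
    · obtain ⟨x, hx, y, hy, hxy⟩ := hsB
      have hyx : y ∈ s.erase x := mem_erase.2 ⟨hxy.ne', hy⟩
      have h1 : ((s.erase x).erase y).card = 1 := by
        rw [card_erase_of_mem hyx, card_erase_of_mem hx, hs3]
      obtain ⟨z, hz⟩ := card_eq_one.1 h1
      refine mem_union_right _ (mem_union_right _ (mem_image.2 ⟨((x, y), z), ?_, ?_⟩))
      · simp only [mem_product, mem_univ, and_true]
        exact mem_biUnion.2 ⟨x, mem_univ x, mem_image.2 ⟨y, P.mem_badNbrs.2 hxy, rfl⟩⟩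
      · change insert x (insert y ({z} : Finset (Fin n))) = s
        rw [← hz, insert_erase hyx, insert_erase hx]
    push Not at hsB
    have hd : ∀ v : ↥P.clean, (∀ x ∈ v.1, x ∈ Z) → (∀ x ∈ P.badStar v.1, x ∈ Z) →
        (⟨s, P.mem_clean.2 ⟨hs3, hsB⟩⟩ : ↥P.clean) ∈ P.level v.1 0 := by
      intro v h1 h2
      refine P.mem_level.2 ⟨fun x hx h => hsZ x hx (h2 x h), card_eq_zero.2 ?_⟩
      rw [← disjoint_iff_inter_eq_empty, disjoint_left]
      exact fun x hx h => hsZ x hx (h1 x h)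
    refine mem_union_left _ (mem_image.2 ⟨⟨s, P.mem_clean.2 ⟨hs3, hsB⟩⟩, mem_inter.2 ⟨?_, ?_⟩, rfl⟩)
    · refine hd t (fun x hx => ?_) fun x hx => ?_ <;> simp [Z, hx]
    · refine hd u (fun x hx => ?_) fun x hx => ?_ <;> simp [Z, hx]
  have h := card_le_card hsub
  have h' : (powersetCard 3 (univ : Finset (Fin n))).card ≤
      (P.level t.1 0 ∩ P.level u.1 0).card + (Z.card * (n * n) + B.card * n) := by
    refine h.trans ((card_union_le _ _).trans (add_le_add card_image_le
      ((card_union_le _ _).trans (add_le_add (card_image_le.trans ?_) (card_image_le.trans ?_)))))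
    · simp
    · simp
  rw [card_powersetCard, card_univ, Fintype.card_fin] at h'
  have hc : n.choose 3 * 6 = n * (n - 1) * (n - 2) := by
    have := Nat.descFactorial_eq_factorial_mul_choose n 3
    rw [show Nat.factorial 3 = 6 from rfl] at this
    rw [mul_comm, ← this]
    simp [Nat.descFactorial]
    ring
  have hc' : (n.choose 3 : ℝ) * 6 = n * (n - 1) * (n - 2) := by
    have := congrArg (Nat.cast : ℕ → ℝ) hc
    push_cast [Nat.cast_sub (show 1 ≤ n by omega), Nat.cast_sub (show 2 ≤ n by omega)] at this
    exact this
  have h'' : (n.choose 3 : ℝ) ≤ (P.level t.1 0 ∩ P.level u.1 0).card +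
      ((6 + 6 * P.maxBadDegree) * (n * n) + n * P.maxBadDegree * n) := by
    have h3 : n.choose 3 ≤ (P.level t.1 0 ∩ P.level u.1 0).card +
        ((6 + 6 * P.maxBadDegree) * (n * n) + n * P.maxBadDegree * n) := by
      refine h'.trans ?_
      gcongr
    exact_mod_cast h3
  have hn' : (1000 : ℝ) ≤ n := by exact_mod_cast hn
  -- The leading coefficient is 1/6 - 7/200 > 0.131, so the quadratic terms fit into the gap above
  -- 3/32.
  have e1 : (P.maxBadDegree : ℝ) * n ^ 2 ≤ n / 200 * n ^ 2 := by gcongr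
  have e2 : 1000 * (n : ℝ) ^ 2 ≤ n ^ 3 := by nlinarith [sq_nonneg (n : ℝ)]
  nlinarith

/-- The oscillation of a solution of the weighted clean Poisson equation. -/
theorem sub_le_of_abs_laplacian_le {θ : P.CleanCon → ℝ} {x : ↥P.clean → ℝ} {m₀ D : ℝ}
    (hm : 1 / 4 ≤ m₀) (hn : 1000 ≤ n) (hΔ : (P.maxBadDegree : ℝ) ≤ n / 200)
    (hθ : ∀ c, m₀ ≤ θ c ∧ θ c ≤ 1)
    (hb : ∀ u, |(P.laplacian θ).mulVec x u| ≤ D) (a b : ↥P.clean) :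
    x a - x b ≤ 32 / n * (D / m₀) := by
  have : Nonempty ↥P.clean := ⟨a⟩
  obtain ⟨t, ht⟩ := Finite.exists_max x
  obtain ⟨u, hu⟩ := Finite.exists_min x
  have h1 := P.sum_level_zero_le hm hn hΔ hθ t ht hb
  have h2 := P.sum_level_zero_le (x := -x) hm hn hΔ hθ u (fun v => neg_le_neg (hu v))
    (fun v => by rw [Matrix.mulVec_neg, Pi.neg_apply, abs_neg]; exact hb v)
  have h3 := P.le_card_level_inter hn hΔ t u
  -- Each common triangle `j` splits x t - x u into the drop from the maximum and the rise from the
  -- minimum.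
  have h4 : ((P.level t.1 0 ∩ P.level u.1 0).card : ℝ) * (x t - x u) ≤
      ∑ j ∈ P.level t.1 0, (x t - x j) + ∑ j ∈ P.level u.1 0, ((-x) u - (-x) j) := by
    have e1 : ∑ j ∈ P.level t.1 0 ∩ P.level u.1 0, (x t - x j) ≤ ∑ j ∈ P.level t.1 0, (x t - x j) :=
      sum_le_sum_of_subset_of_nonneg inter_subset_left fun j _ _ => sub_nonneg.2 (ht j)
    have e2 : ∑ j ∈ P.level t.1 0 ∩ P.level u.1 0, ((-x) u - (-x) j) ≤
        ∑ j ∈ P.level u.1 0, ((-x) u - (-x) j) :=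
      sum_le_sum_of_subset_of_nonneg inter_subset_right fun j _ _ =>
        sub_nonneg.2 (neg_le_neg (hu j))
    refine le_trans (le_of_eq ?_) (add_le_add e1 e2)
    rw [← sum_add_distrib, ← nsmul_eq_mul, ← sum_const]
    refine sum_congr rfl fun j _ => ?_
    simp only [Pi.neg_apply]
    ring
  have hn' : (1000 : ℝ) ≤ n := by exact_mod_cast hn
  have h5 : x a - x b ≤ x t - x u := sub_le_sub (ht a) (hu b)
  have h6 : 0 ≤ x t - x u := sub_nonneg.2 (ht u)
  have h7 : 3 / 32 * (n : ℝ) ^ 3 * (x t - x u) ≤ 3 * n ^ 2 * (D / m₀) := by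
    have := mul_le_mul_of_nonneg_right h3 h6
    linarith
  refine h5.trans ?_
  have h8 : 0 < 3 / 32 * (n : ℝ) ^ 3 := by positivity
  refine le_of_mul_le_mul_left (h7.trans (le_of_eq ?_)) h8
  field_simp

end SyncProblem

end

end TriP

namespace TriP

noncomputable section

open Finset

/-! ### Gauge seminorm and pseudoinverse -/

theorem gaugeNorm_le {ι : Type*} [Fintype ι] (x : ι → ℝ) (α : ℝ) : gaugeNorm x ≤ ‖x - fun _ => α‖ :=
  ciInf_le ⟨0, by rintro _ ⟨β, rfl⟩; exact norm_nonneg _⟩ α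

theorem gaugeNorm_le_of_sub_le {ι : Type*} [Fintype ι] [Nonempty ι] {x : ι → ℝ} {R : ℝ}
    (h : ∀ a b, x a - x b ≤ 2 * R) : gaugeNorm x ≤ R := by
  obtain ⟨t, ht⟩ := Finite.exists_max x
  obtain ⟨u, hu⟩ := Finite.exists_min x
  have h1 := h t u
  have hR : 0 ≤ R := by linarith [ht u]
  -- The midrange is the gauge that halves the oscillation.
  refine (gaugeNorm_le x ((x t + x u) / 2)).trans ((pi_norm_le_iff_of_nonneg hR).2 fun i => ?_)
  rw [Pi.sub_apply, Real.norm_eq_abs, abs_le]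
  constructor <;> linarith [ht i, hu i]

theorem abs_sub_le_two_mul_gaugeNorm {ι : Type*} [Fintype ι] (x : ι → ℝ) (i j : ι) :
    |x i - x j| ≤ 2 * gaugeNorm x := by
  suffices |x i - x j| / 2 ≤ gaugeNorm x by linarith
  refine le_ciInf fun α => ?_
  have h1 := norm_le_pi_norm (x - fun _ => α) i
  have h2 := norm_le_pi_norm (x - fun _ => α) j
  rw [Pi.sub_apply, Real.norm_eq_abs] at h1 h2
  have h3 : |x i - x j| ≤ |x i - α| + |x j - α| := by
    rw [abs_sub_comm (x j) α]
    exact abs_sub_le _ _ _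
  linarith

theorem exists_isPenroseInverse {ι : Type*} [Fintype ι] {M : Matrix ι ι ℝ}
    (hM : M.transpose = M) : ∃ X, IsPenroseInverse M X := by
  classical
  have hH : M.IsHermitian := by rwa [Matrix.IsHermitian, Matrix.conjTranspose_eq_transpose_of_trivial]
  obtain ⟨U, V, d, hUV, hVU, hM'⟩ : ∃ (U V : Matrix ι ι ℝ) (d : ι → ℝ), U * V = 1 ∧
      V = U.transpose ∧ M = U * Matrix.diagonal d * V := by
    refine ⟨hH.eigenvectorUnitary, star (hH.eigenvectorUnitary : Matrix ι ι ℝ), hH.eigenvalues,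
      Unitary.coe_mul_star_self _, ?_, ?_⟩
    · rw [Matrix.star_eq_conjTranspose, Matrix.conjTranspose_eq_transpose_of_trivial]
    · have := hH.spectral_theorem
      rw [Unitary.conjStarAlgAut_apply] at this
      exact this
  have hVU' : V * U = 1 := mul_eq_one_comm.1 hUV
  have hmul : ∀ a b : ι → ℝ, (U * Matrix.diagonal a * V) * (U * Matrix.diagonal b * V) =
      U * Matrix.diagonal (fun i => a i * b i) * V := fun a b => by
    rw [← Matrix.diagonal_mul_diagonal]
    calc _ = U * Matrix.diagonal a * (V * U) * Matrix.diagonal b * V := by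
          simp only [Matrix.mul_assoc]
      _ = _ := by rw [hVU']; simp only [Matrix.mul_assoc, Matrix.mul_one]
  have htr : ∀ a : ι → ℝ, (U * Matrix.diagonal a * V).transpose = U * Matrix.diagonal a * V :=
    fun a => by
      rw [hVU, Matrix.transpose_mul, Matrix.transpose_mul, Matrix.transpose_transpose,
        Matrix.diagonal_transpose, Matrix.mul_assoc]
  -- The convention `0⁻¹ = 0` inverts exactly the nonzero eigenvalues.
  refine ⟨U * Matrix.diagonal (fun i => (d i)⁻¹) * V, ?_, ?_, ?_, ?_⟩
  · rw [hM', hmul, hmul]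
    congr 3
    funext i
    exact mul_inv_mul_cancel (d i)
  · rw [hM', hmul, hmul]
    congr 3
    funext i
    simpa using mul_inv_mul_cancel (d i)⁻¹
  · rw [hM', hmul, htr]
  · rw [hM', hmul, htr]

theorem isPenroseInverse_pinv {ι : Type*} [Fintype ι] {M : Matrix ι ι ℝ}
    (hM : M.transpose = M) : IsPenroseInverse M (pinv M) := by
  rw [pinv, dif_pos (exists_isPenroseInverse hM)]
  exact (exists_isPenroseInverse hM).choose_spec

/-- The pseudoinverse solves every equation whose data is orthogonal to the kernel `ℝ 𝟏`. -/
theorem mulVec_pinv_mulVec {ι : Type*} [Fintype ι] {M : Matrix ι ι ℝ} (hM : M.transpose = M)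
    (hker : ∀ x, M.mulVec x = 0 → ∀ i j, x i = x j) (hsum : ∀ x, ∑ i, M.mulVec x i = 0)
    {b : ι → ℝ} (hb : ∑ i, b i = 0) : M.mulVec ((pinv M).mulVec b) = b := by
  obtain ⟨h1, -, h3, -⟩ := isPenroseInverse_pinv hM
  -- This is the transposed first Penrose equation. It puts the residual of the pseudosolution in
  -- the kernel, so that residual is constant; having zero sum, it vanishes.
  have h4 : M * (M * pinv M) = M := by
    have := congrArg Matrix.transpose h1
    rw [Matrix.transpose_mul, h3, hM] at this
    exact this
  have h5 : M.mulVec (b - M.mulVec ((pinv M).mulVec b)) = 0 := by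
    rw [Matrix.mulVec_sub, Matrix.mulVec_mulVec, Matrix.mulVec_mulVec, Matrix.mul_assoc, h4,
      sub_self]
  have h6 := hker _ h5
  funext i
  have h7 : ∑ j, (b - M.mulVec ((pinv M).mulVec b)) j = 0 := by
    simp only [Pi.sub_apply, sum_sub_distrib, hb, hsum, sub_self]
  rw [sum_congr rfl fun j _ => h6 j i, sum_const, card_univ, nsmul_eq_mul] at h7
  have : Nonempty ι := ⟨i⟩
  have h8 : (Fintype.card ι : ℝ) ≠ 0 := by exact_mod_cast Fintype.card_ne_zero
  have := (mul_eq_zero.1 h7).resolve_left h8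
  rw [Pi.sub_apply, sub_eq_zero] at this
  exact this.symm

namespace SyncProblem

variable {n : ℕ} (P : SyncProblem n)

/-! ### Connectedness, kernel and Green response of the clean overlap graph. -/

theorem laplacian_transpose (θ : P.CleanCon → ℝ) : (P.laplacian θ).transpose = P.laplacian θ := by
  classical
  rw [laplacian, Matrix.transpose_mul, Matrix.transpose_mul, Matrix.transpose_transpose,
    Matrix.diagonal_transpose, Matrix.mul_assoc]

theorem sum_laplacian (θ : P.CleanCon → ℝ) (x : ↥P.clean → ℝ) :
    ∑ t, (P.laplacian θ).mulVec x t = 0 := by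
  have := P.sum_mul_laplacian θ (fun _ => 1) x
  simpa using this

/-- Greedy choice: at most two chosen cameras exclude at most 2 + 2Δ < n candidates for the next
one. -/
theorem nonempty_clean (hn : 1000 ≤ n) (hΔ : (P.maxBadDegree : ℝ) ≤ n / 200) :
    Nonempty ↥P.clean := by
  classical
  have hΔ' : 200 * P.maxBadDegree ≤ n := by
    have : 200 * (P.maxBadDegree : ℝ) ≤ n := by linarith
    exact_mod_cast this
  have key : ∀ s : Finset (Fin n), s.card ≤ 2 → ∃ x, x ∉ s ∧ x ∉ P.badStar s := by
    intro s hs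
    by_contra! h
    have h1 : (univ : Finset (Fin n)) ⊆ s ∪ P.badStar s := fun x _ => by
      by_cases hx : x ∈ s
      · exact mem_union_left _ hx
      · exact mem_union_right _ (h x hx)
    have h2 := (card_le_card h1).trans (card_union_le _ _)
    have h3 := P.card_badStar_le s
    rw [card_univ, Fintype.card_fin] at h2
    have : s.card * P.maxBadDegree ≤ 2 * P.maxBadDegree := Nat.mul_le_mul_right _ hs
    omega
  obtain ⟨x, -⟩ := key ∅ (by simp)
  obtain ⟨y, hy, hy'⟩ := key {x} (by simp)
  obtain ⟨z, hz, hz'⟩ := key {x, y} card_le_two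
  simp only [mem_badStar, mem_singleton, exists_eq_left, mem_insert, not_or, exists_eq_or_imp]
    at hy hy' hz hz'
  refine ⟨⟨{x, y, z}, P.mem_clean.2 ⟨card_eq_three.2 ⟨x, y, z, Ne.symm hy, Ne.symm hz.1,
    Ne.symm hz.2, rfl⟩, ?_⟩⟩⟩
  have := P.bad.loopless.irrefl
  have hc := fun a b => P.bad.adj_comm a b
  simp only [mem_insert, mem_singleton, forall_eq_or_imp, forall_eq]
  grind

/-- The indicator of a component is harmonic for unit weights, so the oscillation bound with D = 0
makes it constant. -/
theorem overlapGraph_connected (hn : 1000 ≤ n) (hΔ : (P.maxBadDegree : ℝ) ≤ n / 200) :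
    P.overlapGraph.Connected := by
  classical
  have := P.nonempty_clean hn hΔ
  refine ⟨fun a b => ?_⟩
  let x : ↥P.clean → ℝ := fun t => if P.overlapGraph.Reachable a t then 1 else 0
  have hx : ∀ c : P.CleanCon, x c.1.2 = x c.1.1 := by
    intro c
    have hadj : P.overlapGraph.Adj c.1.1 c.1.2 :=
      ⟨fun h => absurd c.2.2 (by rw [h]; exact lt_irrefl _), c.2.1⟩
    have : P.overlapGraph.Reachable a c.1.2 ↔ P.overlapGraph.Reachable a c.1.1 :=
      ⟨fun h => h.trans hadj.symm.reachable, fun h => h.trans hadj.reachable⟩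
    simp only [x, this]
  have hL : ∀ u, |(P.laplacian fun _ => 1).mulVec x u| ≤ 0 := by
    intro u
    have := P.sum_mul_laplacian (fun _ => 1) (Pi.single u 1) x
    simp only [hx, sub_self, mul_zero, sum_const_zero] at this
    simp only [Pi.single_apply, ite_mul, one_mul, zero_mul, sum_ite_eq', mem_univ, if_true] at this
    rw [this, abs_zero]
  have h := P.sub_le_of_abs_laplacian_le (m₀ := 1) (by norm_num) hn hΔ
    (fun _ => ⟨le_rfl, le_rfl⟩) hL a b
  by_contra hab
  simp only [x, SimpleGraph.Reachable.refl, if_true, hab, if_false] at h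
  norm_num at h

theorem gaugeNorm_le_of_abs_laplacian_le {θ : P.CleanCon → ℝ} {x : ↥P.clean → ℝ} {m₀ D : ℝ}
    (hm : 1 / 4 ≤ m₀) (hn : 1000 ≤ n) (hΔ : (P.maxBadDegree : ℝ) ≤ n / 200)
    (hθ : ∀ c, m₀ ≤ θ c ∧ θ c ≤ 1)
    (hb : ∀ u, |(P.laplacian θ).mulVec x u| ≤ D) : gaugeNorm x ≤ 16 / n * (D / m₀) := by
  have := P.nonempty_clean hn hΔ
  refine gaugeNorm_le_of_sub_le fun a b => ?_
  refine (P.sub_le_of_abs_laplacian_le hm hn hΔ hθ hb a b).trans (le_of_eq ?_)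
  ring

theorem laplacian_ker {θ : P.CleanCon → ℝ} {m₀ : ℝ}
    (hm : 1 / 4 ≤ m₀) (hn : 1000 ≤ n) (hΔ : (P.maxBadDegree : ℝ) ≤ n / 200)
    (hθ : ∀ c, m₀ ≤ θ c ∧ θ c ≤ 1) (x : ↥P.clean → ℝ) (hx : (P.laplacian θ).mulVec x = 0)
    (a b : ↥P.clean) : x a = x b := by
  have h := P.sub_le_of_abs_laplacian_le (D := 0) hm hn hΔ hθ (x := x) (by simp [hx])
  simp only [zero_div, mul_zero] at h
  linarith [h a b, h b a]

theorem qmin_bounds (hn : 1000 ≤ n) (hΔ : (P.maxBadDegree : ℝ) ≤ n / 200) :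
    (n : ℝ) - 2 - 2 * P.maxBadDegree ≤ P.qmin ∧ P.qmin ≤ n := by
  classical
  obtain ⟨t⟩ := P.nonempty_clean hn hΔ
  have ht := P.mem_clean.1 t.2
  obtain ⟨x, y, z, hxy, -, -, he⟩ := card_eq_three.1 ht.1
  have hadj : P.badᶜ.Adj x y := by
    rw [SimpleGraph.compl_adj]
    exact ⟨hxy, ht.2 x (by simp [he]) y (by simp [he])⟩
  -- Without a clean edge `sInf ∅ = 0` would break the lower bound; a clean triangle supplies one.
  have hne : {q | ∃ i j, P.badᶜ.Adj i j ∧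
      q = {k | P.badᶜ.Adj i k ∧ P.badᶜ.Adj j k}.ncard}.Nonempty := ⟨_, x, y, hadj, rfl⟩
  obtain ⟨i, j, hij, hq⟩ := Nat.sInf_mem hne
  change P.qmin = _ at hq
  rw [hq]
  constructor
  · have hsub : (univ : Finset (Fin n)) ⊆
        {k | P.badᶜ.Adj i k ∧ P.badᶜ.Adj j k}.toFinset ∪
          ({i, j} ∪ (P.badNbrs i ∪ P.badNbrs j)) := by
      intro k _
      simp only [mem_union, Set.mem_toFinset, Set.mem_ofPred_eq, SimpleGraph.compl_adj, mem_insert,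
        mem_singleton, mem_badNbrs]
      have h1 : i = k ↔ k = i := eq_comm
      have h2 : j = k ↔ k = j := eq_comm
      tauto
    have h := (card_le_card hsub).trans ((card_union_le _ _).trans (add_le_add le_rfl
      ((card_union_le _ _).trans (add_le_add card_le_two ((card_union_le _ _).trans
        (add_le_add (P.card_badNbrs_le i) (P.card_badNbrs_le j)))))))
    rw [card_univ, Fintype.card_fin, ← Set.ncard_eq_toFinset_card'] at h
    have h' : (n : ℝ) ≤ ({k | P.badᶜ.Adj i k ∧ P.badᶜ.Adj j k}.ncard : ℕ) +
        (2 + (P.maxBadDegree + P.maxBadDegree)) := by exact_mod_cast h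
    linarith
  · have := Set.ncard_le_card {k | P.badᶜ.Adj i k ∧ P.badᶜ.Adj j k}
    rwa [Nat.card_fin] at this

theorem sixteen_div_le (hn : 1000 ≤ n) (hΔ : (P.maxBadDegree : ℝ) ≤ n / 200) :
    (16 : ℝ) / n ≤ 16 / ((P.qmin : ℝ) - 1) := by
  obtain ⟨h1, h2⟩ := P.qmin_bounds hn hΔ
  have hn' : (1000 : ℝ) ≤ n := by exact_mod_cast hn
  have h2' : (P.qmin : ℝ) ≤ n := by exact_mod_cast h2
  exact div_le_div_of_nonneg_left (by norm_num) (by linarith) (by linarith)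

/-- The pseudoinverse solves the Poisson equation with right-hand side Aᵀs, whose entries are at
most d‖s‖ by the column norms; the oscillation bound does the rest. -/
theorem isGreenResponse {m₀ : ℝ} (hm : 1 / 4 ≤ m₀) (hn : 1000 ≤ n)
    (hΔ : (P.maxBadDegree : ℝ) ≤ n / 200) (d : ℕ) :
    P.IsGreenResponse m₀ d (16 / ((P.qmin : ℝ) - 1)) := by
  intro r A θ s _ hcol hθ hs
  have hm0 : 0 < m₀ := by linarith
  have hsol : (P.laplacian θ).mulVec ((pinv (P.laplacian θ)).mulVec (A.transpose.mulVec s)) =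
      A.transpose.mulVec s :=
    mulVec_pinv_mulVec (P.laplacian_transpose θ) (P.laplacian_ker hm hn hΔ hθ)
      (P.sum_laplacian θ) hs
  have hb : ∀ u, |A.transpose.mulVec s u| ≤ d * ‖s‖ := by
    intro u
    refine (abs_sum_le_sum_abs (fun f => A f u * s f) univ).trans ?_
    refine le_trans ?_ (mul_le_mul_of_nonneg_right (hcol u) (norm_nonneg s))
    rw [sum_mul]
    refine sum_le_sum fun f _ => ?_
    rw [abs_mul]
    exact mul_le_mul_of_nonneg_left (norm_le_pi_norm s f) (abs_nonneg _)
  have h := P.gaugeNorm_le_of_abs_laplacian_le hm hn hΔ hθ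
    (x := (pinv (P.laplacian θ)).mulVec (A.transpose.mulVec s)) (by rw [hsol]; exact hb)
  refine h.trans ?_
  calc 16 / n * (d * ‖s‖ / m₀) ≤ 16 / ((P.qmin : ℝ) - 1) * (d * ‖s‖ / m₀) := by
        exact mul_le_mul_of_nonneg_right (P.sixteen_div_le hn hΔ) (by positivity)
    _ = _ := by ring

/-! ### The corrupted boundary degree -/

/-- A corrupted constraint at `t` leads to a non-clean triangle obtained by exchanging one of 3
cameras for one with a corrupted edge to one of the 2 kept cameras, hence at most 3·2Δ choices. -/
theorem sum_abs_badRow_le (hP : P.Valid) (t : ↥P.clean) :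
    ∑ f, |P.badRow f t| ≤ 6 * P.maxBadDegree := by
  classical
  have hle : ∀ f, |P.badRow f t| ≤ if P.badRow f t ≠ 0 then 1 else 0 := by
    intro f
    unfold badRow
    split_ifs <;> norm_num at *
  have hcase : ∀ f : P.BadCon, P.badRow f t ≠ 0 → ∃ u : Finset (Fin n), ∃ hu : u ∈ P.nuis,
      (f.1 = (Sum.inl t, Sum.inr ⟨u, hu⟩) ∨ f.1 = (Sum.inr ⟨u, hu⟩, Sum.inl t)) := by
    intro f hf
    have h3 := f.2.2.2
    rcases hf1 : f.1.1 with a | a <;> rcases hf2 : f.1.2 with b | b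
    · rw [hf1, hf2] at h3
      simp at h3
    · have : a = t := by
        by_contra h
        simp [badRow, hf1, hf2, h] at hf
      exact ⟨b.1, b.2, Or.inl (by rw [← this, ← hf1, ← hf2])⟩
    · have : b = t := by
        by_contra h
        simp [badRow, hf1, hf2, h] at hf
      exact ⟨a.1, a.2, Or.inr (by rw [← this, ← hf1, ← hf2])⟩
    · simp [badRow, hf1, hf2] at hf
  have hcard : (univ.filter fun f => P.badRow f t ≠ 0).card ≤ 6 * P.maxBadDegree := by
    choose! g hg using hcase
    -- The non-clean triangle determines the constraint, because the colexicographic order fixes the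
    -- orientation.
    have hinj : Set.InjOn g (univ.filter fun f => P.badRow f t ≠ 0 : Finset _) := by
      intro f hf f' hf' he
      have hf : P.badRow f t ≠ 0 := by simpa using hf
      have hf' : P.badRow f' t ≠ 0 := by simpa using hf'
      obtain ⟨u1, h1⟩ := hg f hf
      obtain ⟨u2, h2⟩ := hg f' hf'
      simp only [← he] at h2
      have o1 := f.2.2.1
      have o2 := f'.2.2.1
      refine Subtype.ext ?_
      rcases h1 with h1 | h1 <;> rcases h2 with h2 | h2
      · rw [h1, h2]
      · rw [h1] at o1
        rw [h2] at o2
        exact absurd o1 o2.not_gt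
      · rw [h1] at o1
        rw [h2] at o2
        exact absurd o1 o2.not_gt
      · rw [h1, h2]
    have hsub : (univ.filter fun f => P.badRow f t ≠ 0).image g ⊆
        t.1.biUnion fun w => (P.badStar (t.1.erase w)).image fun z => insert z (t.1.erase w) := by
      intro u hu
      rw [mem_image] at hu
      obtain ⟨f, hf, rfl⟩ := hu
      have hf : P.badRow f t ≠ 0 := by simpa using hf
      obtain ⟨hu3, huc⟩ := hP.1 (g f) (hg f hf).1
      have hsh : SharesEdge t.1 (g f) := by
        have h1 := f.2.1
        rcases (hg f hf).2 with h | h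
        · rw [h] at h1
          exact h1
        · rw [h] at h1
          exact SharesEdge.symm h1
      obtain ⟨w, hw, z, hz, -, hu⟩ := exists_eq_insert_erase (P.card_clean t) hu3 hsh
      simp only [mem_biUnion, mem_image]
      refine ⟨w, hw, z, ?_, hu.symm⟩
      rw [mem_badStar]
      by_contra! hno
      refine huc (P.mem_clean.2 ⟨hu3, fun i hi j hj => ?_⟩)
      rw [hu, mem_insert] at hi hj
      rcases hi with rfl | hi <;> rcases hj with rfl | hj
      · exact P.bad.loopless.irrefl _
      · exact fun h => hno j hj h.symm
      · exact hno i hi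
      · exact (P.mem_clean.1 t.2).2 i (mem_of_mem_erase hi) j (mem_of_mem_erase hj)
    rw [← card_image_of_injOn hinj]
    refine (card_le_card hsub).trans ((card_biUnion_le_card_mul _ _ (2 * P.maxBadDegree)
      fun w hw => card_image_le.trans ?_).trans ?_)
    · have := P.card_badStar_le (t.1.erase w)
      rwa [card_erase_of_mem hw, P.card_clean] at this
    · rw [P.card_clean]
      omega
  refine (sum_le_sum fun f _ => hle f).trans ?_
  rw [sum_boole]
  exact_mod_cast hcard

theorem cleanBoundaryBadDegree_nonneg : 0 ≤ P.cleanBoundaryBadDegree :=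
  Real.iSup_nonneg fun _ => sum_nonneg fun _ _ => abs_nonneg _

theorem cleanBoundaryBadDegree_le (hP : P.Valid) :
    P.cleanBoundaryBadDegree ≤ 6 * P.maxBadDegree :=
  Real.iSup_le (fun t => P.sum_abs_badRow_le hP t) (by positivity)

theorem sum_abs_badRow_le_cleanBoundaryBadDegree (t : ↥P.clean) :
    ∑ f, |P.badRow f t| ≤ P.cleanBoundaryBadDegree :=
  le_ciSup (f := fun t => ∑ f, |P.badRow f t|) (Set.finite_range _).bddAbove t

/-- The small-gain condition holds for all large camera graphs. -/
theorem exists_smallGain {h : ℝ} (hh : 16 / 33 < h) :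
    ∃ N : ℕ, 1000 ≤ N ∧ ∀ n : ℕ, N ≤ n → ∀ P : SyncProblem n, P.Valid →
      (P.maxBadDegree : ℝ) ≤ n / 200 →
        16 / ((P.qmin : ℝ) - 1) * P.cleanBoundaryBadDegree < h := by
  -- From q_min - 1 ≥ 0.99n - 3 and 16·6Δ ≤ 0.48n it is enough that 0.48n < h(0.99n - 3), which is
  -- this bound on `n`.
  obtain ⟨N, hN⟩ := exists_nat_gt (3 * h / (0.99 * (h - 16 / 33)))
  have hpos : 0 < 0.99 * (h - 16 / 33) := by linarith
  refine ⟨max N 1000, le_max_right _ _, fun n hn P hP hΔ => ?_⟩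
  have hn1 : 1000 ≤ n := (le_max_right _ _).trans hn
  have hnN : (N : ℝ) ≤ n := by exact_mod_cast (le_max_left _ _).trans hn
  have hn' : (1000 : ℝ) ≤ n := by exact_mod_cast hn1
  obtain ⟨hq, -⟩ := P.qmin_bounds hn1 hΔ
  have hd := P.cleanBoundaryBadDegree_le hP
  have h1 := (div_lt_iff₀ hpos).1 (hN.trans_le hnN)
  rw [div_mul_eq_mul_div, div_lt_iff₀ (by linarith)]
  have h2 : h * (0.99 * n - 3) ≤ h * ((P.qmin : ℝ) - 1) :=
    mul_le_mul_of_nonneg_left (by linarith) (by linarith)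
  nlinarith

end SyncProblem

end

end TriP

namespace TriP

noncomputable section

open Filter Topology

/-! ### Stationary points of the profiled objective -/

namespace SyncProblem

variable {n : ℕ} (P : SyncProblem n)

/-- The residual of a clean constraint. -/
def residual (z : ↥P.clean → ℝ) (c : P.CleanCon) : ℝ :=
  z c.1.2 - z c.1.1 - P.off c.1.1.1 c.1.2.1

/-- The clean part of the objective. -/
def cleanObjective (L : Loss) (σ : ℝ) (z : ↥P.clean → ℝ) : ℝ := ∑ c, L.rho σ (P.residual z c)

/-- The partial derivative of the clean part of the objective. -/
def cleanGradient (L : Loss) (σ : ℝ) (z : ↥P.clean → ℝ) (t : ↥P.clean) : ℝ :=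
  ∑ c, L.psi σ (P.residual z c) * P.B0 c t

open Classical in
theorem residual_add_smul (z : ↥P.clean → ℝ) (t : ↥P.clean) (h : ℝ) (c : P.CleanCon) :
    P.residual (z + h • Pi.single t 1) c = P.residual z c + h * P.B0 c t := by
  simp only [residual, B0, Pi.add_apply, Pi.smul_apply, Pi.single_apply, smul_eq_mul]
  ring

open Classical in
theorem hasDerivAt_cleanObjective {L : Loss} {σ : ℝ} {z : ↥P.clean → ℝ} (t : ↥P.clean)
    (hd : ∀ c, HasDerivAt (L.rho σ) (L.psi σ (P.residual z c)) (P.residual z c)) :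
    HasDerivAt (fun h : ℝ => P.cleanObjective L σ (z + h • Pi.single t 1))
      (P.cleanGradient L σ z t) 0 := by
  simp only [cleanObjective, residual_add_smul]
  refine HasDerivAt.fun_sum fun c _ => ?_
  have h1 : HasDerivAt (fun h : ℝ => P.residual z c + h * P.B0 c t) (P.B0 c t) 0 := by
    simpa using ((hasDerivAt_id (0 : ℝ)).mul_const (P.B0 c t)).const_add (P.residual z c)
  refine HasDerivAt.comp (h₂ := L.rho σ) 0 ?_ h1
  simpa using hd c

theorem bddBelow_objective (L : Loss) (σ : ℝ) (z : ↥P.clean → ℝ) :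
    BddBelow (Set.range fun zb => P.objective L σ z zb) :=
  ⟨0, by
    rintro _ ⟨zb, rfl⟩
    exact add_nonneg (Finset.sum_nonneg fun _ _ => L.rho_nonneg _)
      (Finset.sum_nonneg fun _ _ => L.rho_nonneg _)⟩

open Classical in
-- For each fixed z_b, moving coordinate `t` by `h` changes the corrupted terms by at most
-- Kσ·∑|a_f(t)|·|h|. A uniform bound survives the infimum, attained or not.
theorem profiled_sub_cleanObjective_le (L : Loss) {σ : ℝ} (hσ : 0 < σ) (z : ↥P.clean → ℝ)
    (t : ↥P.clean) (h : ℝ) :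
    P.profiled L σ (z + h • Pi.single t 1) - P.cleanObjective L σ (z + h • Pi.single t 1) ≤
      P.profiled L σ z - P.cleanObjective L σ z +
        L.peak * σ * (∑ f, |P.badRow f t|) * |h| := by
  set v := z + h • (Pi.single t 1 : ↥P.clean → ℝ) with hv
  suffices ∀ zb, P.profiled L σ v - P.cleanObjective L σ v + P.cleanObjective L σ z -
      L.peak * σ * (∑ f, |P.badRow f t|) * |h| ≤ P.objective L σ z zb by
    have := le_ciInf this
    rw [← profiled] at this
    linarith
  intro zb
  have h1 : P.profiled L σ v ≤ P.objective L σ v zb := ciInf_le (P.bddBelow_objective L σ v) zb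
  have he : ∀ y : P.Var, Sum.elim v zb y =
      Sum.elim z zb y + h * (if y = Sum.inl t then 1 else 0) := by
    rintro (y | y)
    · simp [hv, Pi.single_apply]
    · simp
  have h2 : ∀ w, P.objective L σ w zb = P.cleanObjective L σ w + ∑ f : P.BadCon, L.rho σ
      (Sum.elim w zb f.1.2 - Sum.elim w zb f.1.1 - P.off (P.tri f.1.1) (P.tri f.1.2)) :=
    fun w => rfl
  have h3 : ∑ f : P.BadCon, L.rho σ
        (Sum.elim v zb f.1.2 - Sum.elim v zb f.1.1 - P.off (P.tri f.1.1) (P.tri f.1.2)) ≤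
      ∑ f : P.BadCon, (L.rho σ
        (Sum.elim z zb f.1.2 - Sum.elim z zb f.1.1 - P.off (P.tri f.1.1) (P.tri f.1.2)) +
          L.peak * σ * (|P.badRow f t| * |h|)) := by
    refine Finset.sum_le_sum fun f _ => ?_
    have := (le_abs_self _).trans (L.abs_rho_sub_le hσ
      (Sum.elim v zb f.1.2 - Sum.elim v zb f.1.1 - P.off (P.tri f.1.1) (P.tri f.1.2))
      (Sum.elim z zb f.1.2 - Sum.elim z zb f.1.1 - P.off (P.tri f.1.1) (P.tri f.1.2)))
    have h4 : Sum.elim v zb f.1.2 - Sum.elim v zb f.1.1 - P.off (P.tri f.1.1) (P.tri f.1.2) -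
        (Sum.elim z zb f.1.2 - Sum.elim z zb f.1.1 - P.off (P.tri f.1.1) (P.tri f.1.2)) =
        P.badRow f t * h := by
      rw [he, he, badRow]
      ring
    rw [h4, abs_mul] at this
    linarith
  rw [Finset.sum_add_distrib, ← Finset.mul_sum, ← Finset.sum_mul] at h3
  rw [h2] at h1 ⊢
  linarith

open Classical in
theorem abs_fderiv_profiled_sub_le {L : Loss} {σ : ℝ} (hσ : 0 < σ) {z : ↥P.clean → ℝ}
    (t : ↥P.clean) (hz : DifferentiableAt ℝ (P.profiled L σ) z)
    (hd : ∀ c, HasDerivAt (L.rho σ) (L.psi σ (P.residual z c)) (P.residual z c)) :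
    |fderiv ℝ (P.profiled L σ) z (Pi.single t 1) - P.cleanGradient L σ z t| ≤
      L.peak * σ * ∑ f, |P.badRow f t| := by
  have h1 : HasDerivAt (fun h : ℝ => P.profiled L σ (z + h • Pi.single t 1))
      (fderiv ℝ (P.profiled L σ) z (Pi.single t 1)) 0 := hz.hasFDerivAt.hasLineDerivAt _
  have h2 := h1.sub (P.hasDerivAt_cleanObjective t hd)
  have hC : 0 ≤ L.peak * σ * ∑ f, |P.badRow f t| :=
    mul_nonneg (mul_nonneg L.peak_pos.le hσ.le) (Finset.sum_nonneg fun _ _ => abs_nonneg _)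
  refine h2.le_of_lip' hC (Eventually.of_forall fun h => ?_)
  simp only [Pi.sub_apply, zero_smul, add_zero, sub_zero, Real.norm_eq_abs]
  have h3 := P.profiled_sub_cleanObjective_le L hσ z t h
  -- Moving back by -h gives the reverse inequality.
  have h4 := P.profiled_sub_cleanObjective_le L hσ (z + h • Pi.single t 1) t (-h)
  rw [neg_smul, add_neg_cancel_right, abs_neg] at h4
  rw [abs_le]
  constructor <;> linarith

/-- Exact offsets make a clean residual a difference of two entries of z - z⋆, hence at most twice
the gauge norm. -/
theorem abs_residual_le {a σ : ℝ} {z : ↥P.clean → ℝ} (hP : P.Valid)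
    (hz : P.err z ≤ a / 2 * σ) (c : P.CleanCon) : |P.residual z c| ≤ a * σ := by
  have h := abs_sub_le_two_mul_gaugeNorm (fun t => z t - P.zstar t.1) c.1.2 c.1.1
  have he : P.residual z c =
      (z c.1.2 - P.zstar c.1.2.1) - (z c.1.1 - P.zstar c.1.1.1) := by
    rw [residual, hP.2 _ c.1.1.2 _ c.1.2.2 c.2.1]
    ring
  rw [he]
  unfold err at hz
  linarith

theorem continuous_residual (c : P.CleanCon) : Continuous fun z => P.residual z c := by
  unfold residual
  fun_prop

/-- Stationarity bounds the clean gradient by the total influence of the corrupted rows. -/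
theorem abs_cleanGradient_le {L : Loss} {a σ : ℝ} {z : ↥P.clean → ℝ} (hP : P.Valid) (hσ : 0 < σ)
    (hw : 0 < L.weight a) (hz : P.CleanBasinStationary L a σ z) (t : ↥P.clean) :
    |P.cleanGradient L σ z t| ≤ L.peak * σ * ∑ f, |P.badRow f t| := by
  classical
  set C := L.peak * σ * ∑ f, |P.badRow f t|
  have hr := P.abs_residual_le hP hz.2
  have hev : ∀ᶠ u in 𝓝 z, ∀ c,
      HasDerivAt (L.rho σ) (L.psi σ (P.residual u c)) (P.residual u c) := by
    rw [eventually_all]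
    exact fun c => (P.continuous_residual c).continuousAt.eventually
      (L.eventually_hasDerivAt hσ hw (hr c))
  have hcont : Tendsto (fun u => P.cleanGradient L σ u t) (𝓝 z) (𝓝 (P.cleanGradient L σ z t)) := by
    refine tendsto_finsetSum _ fun c _ => Tendsto.mul_const _ ?_
    exact (L.continuousAt_psi hσ hw (hr c)).tendsto.comp (P.continuous_residual c).continuousAt
  -- The bound on a partial derivative is closed and convex, so it passes to limits of derivatives
  -- and to their convex hull.
  have hsub : clarkeSubdifferential (P.profiled L σ) z ⊆
      (fun ξ : (↥P.clean → ℝ) →L[ℝ] ℝ => ξ (Pi.single t 1)) ⁻¹'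
        Metric.closedBall (P.cleanGradient L σ z t) C := by
    refine convexHull_min ?_ ((convex_closedBall _ C).is_linear_preimage ⟨fun _ _ => rfl, fun _ _ => rfl⟩)
    rintro ξ ⟨u, hu, hdiff, hlim⟩
    rw [Set.mem_preimage, Metric.mem_closedBall, Real.dist_eq]
    have h1 : Tendsto (fun k => fderiv ℝ (P.profiled L σ) (u k) (Pi.single t 1)) atTop
        (𝓝 (ξ (Pi.single t 1))) :=
      ((ContinuousLinearMap.apply ℝ ℝ (Pi.single t 1 : ↥P.clean → ℝ)).continuous.tendsto ξ).comp hlim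
    refine le_of_tendsto (h1.sub (hcont.comp hu)).abs ?_
    filter_upwards [hu.eventually hev] with k hk
    exact P.abs_fderiv_profiled_sub_le hσ t (hdiff k) hk
  have := hsub hz.1
  simpa [Real.dist_eq] using this

/-- The recovery error of a clean-basin stationary point. -/
theorem err_le {L : Loss} {a σ : ℝ} {z : ↥P.clean → ℝ} (hP : P.Valid) (hσ : 0 < σ) (ha : 0 < a)
    (hw : 1 / 4 ≤ L.weight a) (hn : 1000 ≤ n) (hΔ : (P.maxBadDegree : ℝ) ≤ n / 200)
    (hz : P.CleanBasinStationary L a σ z) :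
    P.err z ≤ 16 / ((P.qmin : ℝ) - 1) * P.cleanBoundaryBadDegree * L.peak / L.weight a * σ := by
  classical
  have hw0 : 0 < L.weight a := by linarith
  have hr := P.abs_residual_le hP hz.2
  set θ : P.CleanCon → ℝ := fun c => L.weight (P.residual z c / σ)
  have hθ : ∀ c, L.weight a ≤ θ c ∧ θ c ≤ 1 := fun c => by
    refine ⟨L.weight_antitone ?_, L.weight_le_one _⟩
    rw [abs_div, abs_of_pos hσ, abs_of_pos ha, div_le_iff₀ hσ]
    exact hr c
  -- With these residual-dependent weights the nonlinear clean gradient is a linear Laplacian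
  -- applied to the error.
  have hlap : ∀ t, (P.laplacian θ).mulVec (fun t => z t - P.zstar t.1) t =
      P.cleanGradient L σ z t := by
    intro t
    have h := P.sum_mul_laplacian θ (fun u => if u = t then 1 else 0) fun t => z t - P.zstar t.1
    simp only [ite_mul, one_mul, zero_mul, Finset.sum_ite_eq', Finset.mem_univ, if_true] at h
    rw [h]
    refine Finset.sum_congr rfl fun c _ => ?_
    rw [L.psi_eq hσ, B0]
    have he : P.residual z c =
        (z c.1.2 - P.zstar c.1.2.1) - (z c.1.1 - P.zstar c.1.1.1) := by
      rw [residual, hP.2 _ c.1.1.2 _ c.1.2.2 c.2.1]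
      ring
    simp only [θ]
    rw [← he]
    ring
  have hb : ∀ t, |(P.laplacian θ).mulVec (fun t => z t - P.zstar t.1) t| ≤
      L.peak * σ * P.cleanBoundaryBadDegree := fun t => by
    rw [hlap]
    refine (P.abs_cleanGradient_le hP hσ hw0 hz t).trans ?_
    exact mul_le_mul_of_nonneg_left (P.sum_abs_badRow_le_cleanBoundaryBadDegree t)
      (mul_nonneg L.peak_pos.le hσ.le)
  refine (P.gaugeNorm_le_of_abs_laplacian_le hw hn hΔ hθ hb).trans ?_
  calc 16 / n * (L.peak * σ * P.cleanBoundaryBadDegree / L.weight a)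
      ≤ 16 / ((P.qmin : ℝ) - 1) * (L.peak * σ * P.cleanBoundaryBadDegree / L.weight a) :=
        mul_le_mul_of_nonneg_right (P.sixteen_div_le hn hΔ) (div_nonneg (mul_nonneg
          (mul_nonneg L.peak_pos.le hσ.le) P.cleanBoundaryBadDegree_nonneg) hw0.le)
    _ = _ := by ring

/-- Blocks whose gauge-invariant error vanishes converge in every consistent gauge. -/
theorem exists_tendsto_of_err_le {z : ℕ → ↥P.clean → ℝ} {C τ : ℝ} (hτ : 0 < τ) (hτ1 : τ < 1)
    (hz : ∀ k, P.err (z k) ≤ C * τ ^ k) (ℓ : (↥P.clean → ℝ) →ₗ[ℝ] ℝ) (hℓ : ℓ (fun _ => 1) = 1) :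
    ∃ αinf : ℝ, ∀ t : ↥P.clean,
      Tendsto (fun k => z k t - ℓ (z k)) atTop (𝓝 (P.zstar t.1 + αinf)) := by
  set zs : ↥P.clean → ℝ := fun t => P.zstar t.1
  -- The slack τ^k allows near-optimal gauges, so attainment of the infimum is not needed.
  have hα : ∀ k, ∃ α : ℝ, ‖(z k - zs) - fun _ => α‖ < C * τ ^ k + τ ^ k := fun k =>
    exists_lt_of_ciInf_lt ((hz k).trans_lt (by linarith [pow_pos hτ k]))
  choose α hα using hα
  have hlim : Tendsto (fun k => (z k - zs) - fun _ => α k) atTop (𝓝 0) := by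
    refine squeeze_zero_norm (fun k => (hα k).le) ?_
    have := tendsto_pow_atTop_nhds_zero_of_lt_one hτ.le hτ1
    simpa using (this.const_mul C).add this
  have hℓlim := (LinearMap.continuous_of_finiteDimensional ℓ).tendsto 0 |>.comp hlim
  refine ⟨-ℓ zs, fun t => ?_⟩
  have ht := (tendsto_pi_nhds.1 hlim t).sub hℓlim
  have h := ht.const_add (zs t + -ℓ zs)
  simp only [map_zero, Pi.zero_apply, sub_zero, add_zero] at h
  refine h.congr fun k => ?_
  have hc : ℓ (fun _ => α k) = α k := by
    have : (fun _ => α k : ↥P.clean → ℝ) = α k • fun _ => 1 := by ext; simp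
    rw [this, map_smul, hℓ, smul_eq_mul, mul_one]
  simp only [Pi.sub_apply, Function.comp_apply, map_sub, hc]
  ring

theorem profiledRecovery {L : Loss} {a : ℝ} (hP : P.Valid) (ha : 0 < a)
    (hw : 1 / 4 ≤ L.weight a) (hn : 1000 ≤ n) (hΔ : (P.maxBadDegree : ℝ) ≤ n / 200)
    (hγ : 16 / ((P.qmin : ℝ) - 1) * P.cleanBoundaryBadDegree < L.hProfAt a) :
    P.ProfiledRecovery L a 16 := by
  have hw0 : 0 < L.weight a := by linarith
  unfold ProfiledRecovery
  simp only [L.lowerSlope_eq ha, L.maxScore_eq]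
  refine ⟨P.overlapGraph_connected hn hΔ, fun d _ => P.isGreenResponse hw hn hΔ d, hγ, ?_⟩
  intro τ σ0 hτ hγτ hτ1 hσ0 z hz
  have hσ : ∀ k, 0 < σ0 * τ ^ k := fun k => by positivity
  have hbasin : ∀ k, P.err (fun t => z k (Sum.inl t)) ≤ a / 2 * σ0 * τ ^ k := fun k => by
    rw [mul_assoc]
    exact (hz k).2
  refine ⟨fun k => ⟨P.err_le hP (hσ k) ha hw hn hΔ (hz k), ?_, hbasin k⟩, fun ℓ hℓ =>
    P.exists_tendsto_of_err_le hτ hτ1 hbasin ℓ hℓ⟩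
  set γ := 16 / ((P.qmin : ℝ) - 1) * P.cleanBoundaryBadDegree
  -- The lower bound on τ says exactly that the error at scale σ_k fits the basin at scale τσ_k.
  have h1 : γ * L.peak / L.weight a ≤ a / 2 * τ := by
    rw [div_lt_iff₀ (by positivity)] at hγτ
    rw [div_le_iff₀ hw0]
    linarith
  calc γ * L.peak / L.weight a * (σ0 * τ ^ k) ≤ a / 2 * τ * (σ0 * τ ^ k) :=
        mul_le_mul_of_nonneg_right h1 (hσ k).le
    _ = _ := by ring

end SyncProblem

end

end TriP

namespace TriP

noncomputable section

open Finset

/-! ### Measured directions give a valid synchronization problem -/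

theorem sum_pair_lt {α : Type*} [LinearOrder α] {p q : α} (h : p < q) (f : α → α → ℝ) :
    ∑ x ∈ {p, q}, ∑ y ∈ {p, q} with x < y, f x y = f p q := by
  rw [sum_pair h.ne]
  simp [filter_insert, filter_singleton, h, h.not_gt]

theorem sum_triple_lt {α : Type*} [LinearOrder α] {p q r : α} (h : p < q) (h' : q < r)
    (f : α → α → ℝ) :
    ∑ x ∈ {p, q, r}, ∑ y ∈ {p, q, r} with x < y, f x y = f p q + f p r + f q r := by
  have h'' := h.trans h'
  rw [sum_insert (by simp [h.ne, h''.ne]), sum_pair h'.ne]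
  simp [filter_insert, filter_singleton, h, h.not_gt, h', h'.not_gt, h'', h''.not_gt]
  rw [sum_pair h'.ne]

theorem powersetCard_two_triple {α : Type*} [DecidableEq α] {p q r : α} (hpq : p ≠ q)
    (hpr : p ≠ r) (hqr : q ≠ r) :
    powersetCard 2 {p, q, r} = ({{p, q}, {p, r}, {q, r}} : Finset (Finset α)) := by
  have hc : powersetCard 2 {q, r} = ({{q, r}} : Finset (Finset α)) := by
    rw [← card_pair hqr, powersetCard_self]
  rw [powersetCard_succ_insert (by simp [hpq, hpr]), hc, powersetCard_one]
  ext e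
  simp only [mem_union, mem_singleton, mem_image, mem_map, mem_insert,
    Function.Embedding.coeFn_mk]
  constructor
  · rintro (rfl | ⟨_, ⟨x, rfl | rfl, rfl⟩, rfl⟩) <;> simp
  · rintro (rfl | rfl | rfl)
    · exact Or.inr ⟨_, ⟨q, Or.inl rfl, rfl⟩, rfl⟩
    · exact Or.inr ⟨_, ⟨r, Or.inr rfl, rfl⟩, rfl⟩
    · exact Or.inl rfl

theorem collinear_of_cross_eq_zero {x y z : EuclideanSpace ℝ (Fin 3)} (hzx : z ≠ x)
    (h : crossProduct (y - z).ofLp (z - x).ofLp = 0) : Collinear ℝ {x, y, z} := by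
  set u := y - z with hu
  set v := z - x with hv
  have hv0 : v ≠ 0 := sub_ne_zero.2 hzx
  have h0 := congrFun h 0
  have h1 := congrFun h 1
  have h2 := congrFun h 2
  simp only [cross_apply, Matrix.cons_val_zero, Matrix.cons_val_one, Matrix.cons_val,
    Pi.zero_apply] at h0 h1 h2
  have hs : v 0 * v 0 + v 1 * v 1 + v 2 * v 2 ≠ 0 := by
    intro hs
    refine hv0 ?_
    ext i
    fin_cases i <;> simp only [Fin.zero_eta, Fin.mk_one, Fin.reduceFinMk, PiLp.zero_apply] <;>
      nlinarith [sq_nonneg (v 0), sq_nonneg (v 1), sq_nonneg (v 2)]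
  obtain ⟨k, hk⟩ : ∃ k : ℝ, u = k • v := by
    -- The multiplier is the projection coefficient (u·v)/(v·v).
    refine ⟨(u 0 * v 0 + u 1 * v 1 + u 2 * v 2) / (v 0 * v 0 + v 1 * v 1 + v 2 * v 2), ?_⟩
    ext i
    rw [PiLp.smul_apply, smul_eq_mul, div_mul_eq_mul_div, eq_div_iff hs]
    fin_cases i <;> simp only [Fin.zero_eta, Fin.mk_one, Fin.reduceFinMk]
    · linear_combination v 1 * h2 - v 2 * h1
    · linear_combination v 2 * h0 - v 0 * h2
    · linear_combination v 0 * h1 - v 1 * h0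
  rw [collinear_iff_of_mem (p₀ := z) (by simp)]
  refine ⟨v, ?_⟩
  simp only [Set.mem_insert_iff, Set.mem_singleton_iff, forall_eq_or_imp, forall_eq, vadd_eq_add]
  refine ⟨⟨-1, ?_⟩, ⟨k, ?_⟩, 0, by simp⟩
  · rw [hv]; simp
  · rw [← hk, hu]; simp

namespace CameraData

variable {n : ℕ} (C : CameraData n)

/-- Twice the area of the triangle `{p, q, r}`. -/
def doubleArea (p q r : Fin n) : ℝ :=
  ‖WithLp.toLp 2 (crossProduct (C.loc q - C.loc r).ofLp (C.loc r - C.loc p).ofLp)‖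

theorem doubleArea_rotate (p q r : Fin n) : C.doubleArea q r p = C.doubleArea p q r := by
  unfold doubleArea
  congr 2
  ext i
  fin_cases i <;> simp [cross_apply] <;> ring

theorem doubleArea_swap (p q r : Fin n) : C.doubleArea p r q = C.doubleArea p q r := by
  unfold doubleArea
  rw [← norm_neg]
  congr 1
  ext i
  fin_cases i <;> simp [cross_apply] <;> ring

theorem norm_cross_trueDir (p q r : Fin n) :
    ‖WithLp.toLp 2 (crossProduct (C.trueDir q r).ofLp (C.trueDir r p).ofLp)‖ =
      ‖C.loc q - C.loc r‖⁻¹ * ‖C.loc r - C.loc p‖⁻¹ * C.doubleArea p q r := by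
  simp only [trueDir, WithLp.ofLp_smul, map_smul, LinearMap.smul_apply, WithLp.toLp_smul,
    norm_smul, norm_inv, norm_norm, doubleArea]
  ring

theorem dir_eq_trueDir {i j : Fin n} (hij : i ≠ j) (h : ¬ C.bad.Adj i j) :
    C.dir i j = C.trueDir i j := by
  by_contra hne
  exact h ((SimpleGraph.fromRel_adj _ _ _).2 ⟨hij, Or.inl hne⟩)

/-- Law of sines: the side ratios of a clean triangle are proportional to its side lengths. -/
theorem exists_sideRatio_eq (hC : C.Valid) {t : Finset (Fin n)} (ht : t ∈ C.toSync.clean) :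
    ∃ c : ℝ, 0 < c ∧ (∀ e ∈ t.powersetCard 2, C.sideRatio t e = c * C.perimeter e) ∧
      ∑ e ∈ t.powersetCard 2, C.perimeter e = C.perimeter t := by
  obtain ⟨h3, hcl⟩ := C.toSync.mem_clean.1 ht
  have hcl : ∀ i ∈ t, ∀ j ∈ t, ¬ C.bad.Adj i j := hcl
  obtain ⟨p, q, r, hpq, hqr, rfl⟩ : ∃ p q r, p < q ∧ q < r ∧ t = {p, q, r} := by
    refine ⟨t.orderEmbOfFin h3 0, t.orderEmbOfFin h3 1, t.orderEmbOfFin h3 2, by simp, by simp, ?_⟩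
    apply coe_injective
    rw [← t.range_orderEmbOfFin h3]
    ext x
    simp only [Set.mem_range, Fin.exists_fin_succ, coe_insert, coe_singleton,
      Set.mem_insert_iff, Set.mem_singleton_iff]
    simp [eq_comm]
  have hpr := hpq.trans hqr
  have hdir : ∀ i ∈ ({p, q, r} : Finset (Fin n)), ∀ j ∈ ({p, q, r} : Finset (Fin n)), i ≠ j →
      C.dir i j = C.trueDir i j := fun i hi j hj hij => C.dir_eq_trueDir hij (hcl i hi j hj)
  have hpos : ∀ {i j}, i ≠ j → 0 < ‖C.loc i - C.loc j‖ := fun hij =>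
    norm_pos_iff.2 (sub_ne_zero.2 fun h => hij (hC.1 h))
  have hA : 0 < C.doubleArea p q r := by
    refine norm_pos_iff.2 fun h => hC.2.2 _ ht ?_
    have := collinear_of_cross_eq_zero (x := C.loc p) (y := C.loc q) (z := C.loc r)
      (fun h => hpr.ne' (hC.1 h)) (by simpa using congrArg WithLp.ofLp h)
    convert this using 1
    simp [Set.image_insert_eq]
  have l1 := hpos hpq.ne
  have l2 := hpos hpr.ne
  have l3 := hpos hqr.ne
  -- The perimeter of a two-camera set is the length of that edge.
  have p1 : C.perimeter {p, q} = ‖C.loc p - C.loc q‖ := sum_pair_lt hpq _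
  have p2 : C.perimeter {p, r} = ‖C.loc p - C.loc r‖ := sum_pair_lt hpr _
  have p3 : C.perimeter {q, r} = ‖C.loc q - C.loc r‖ := sum_pair_lt hqr _
  have s1 : ({p, q, r} : Finset (Fin n)) \ {p, q} = {r} := by
    ext x; simp only [mem_sdiff, mem_insert, mem_singleton]; grind
  have s2 : ({p, q, r} : Finset (Fin n)) \ {p, r} = {q} := by
    ext x; simp only [mem_sdiff, mem_insert, mem_singleton]; grind
  have s3 : ({p, q, r} : Finset (Fin n)) \ {q, r} = {p} := by
    ext x; simp only [mem_sdiff, mem_insert, mem_singleton]; grind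
  rw [powersetCard_two_triple hpq.ne hpr.ne hqr.ne]
  -- Each side ratio is the double area over the product of the two other side lengths; multiplying
  -- and dividing by the side itself gives this common factor.
  refine ⟨C.doubleArea p q r /
    (‖C.loc p - C.loc q‖ * ‖C.loc p - C.loc r‖ * ‖C.loc q - C.loc r‖), by positivity, ?_, ?_⟩
  · intro e he
    simp only [mem_insert, mem_singleton] at he
    rcases he with rfl | rfl | rfl
    · rw [sideRatio, s1, sum_singleton, sum_pair_lt hpq, p1,
        hdir q (by simp) r (by simp) hqr.ne, hdir r (by simp) p (by simp) hpr.ne',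
        norm_cross_trueDir, norm_sub_rev (C.loc r) (C.loc p)]
      field_simp
    · rw [sideRatio, s2, sum_singleton, sum_pair_lt hpr, p2,
        hdir r (by simp) q (by simp) hqr.ne', hdir q (by simp) p (by simp) hpq.ne',
        norm_cross_trueDir, norm_sub_rev (C.loc r) (C.loc q), norm_sub_rev (C.loc q) (C.loc p),
        doubleArea_swap]
      field_simp
    · rw [sideRatio, s3, sum_singleton, sum_pair_lt hqr, p3,
        hdir r (by simp) p (by simp) hpr.ne', hdir p (by simp) q (by simp) hpq.ne,
        norm_cross_trueDir, norm_sub_rev (C.loc r) (C.loc p), doubleArea_rotate]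
      field_simp
  · have d1 : ({p, q} : Finset (Fin n)) ∉ ({{p, r}, {q, r}} : Finset (Finset (Fin n))) := by
      simp only [mem_insert, mem_singleton, not_or]
      constructor <;> intro h <;> have := Finset.ext_iff.1 h q <;> have := Finset.ext_iff.1 h p <;>
        simp_all [hpq.ne, hqr.ne, hpr.ne, hpq.ne']
    have d2 : ({p, r} : Finset (Fin n)) ≠ {q, r} := by
      intro h
      have := Finset.ext_iff.1 h p
      simp [hpq.ne, hpr.ne] at this
    rw [sum_insert d1, sum_pair d2, p1, p2, p3]
    rw [perimeter, sum_triple_lt hpq hqr]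
    ring

theorem perimeter_pos (hC : C.Valid) {t : Finset (Fin n)} (ht : 2 ≤ t.card) :
    0 < C.perimeter t := by
  obtain ⟨p, hp, q, hq, hpq⟩ := one_lt_card.1 ht
  have h0 : ∀ x y, 0 ≤ ‖C.loc x - C.loc y‖ := fun _ _ => norm_nonneg _
  have key : ∀ p ∈ t, ∀ q ∈ t, p < q → 0 < C.perimeter t := by
    intro p hp q hq hpq
    refine sum_pos' (fun x _ => sum_nonneg fun y _ => h0 x y) ⟨p, hp, ?_⟩
    exact sum_pos' (fun y _ => h0 p y) ⟨q, by simp [hq, hpq],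
      norm_pos_iff.2 (sub_ne_zero.2 fun h => hpq.ne (hC.1 h))⟩
  rcases lt_or_gt_of_ne hpq with h | h
  · exact key p hp q hq h
  · exact key q hq p hp h

/-- If c_t is the law-of-sines factor of `t`, then z⋆_t = -log c_t. On a shared edge the length
cancels, and the offset is log c_t - log c_u. -/
theorem toSync_valid (hC : C.Valid) : C.toSync.Valid := by
  classical
  refine ⟨fun t ht => ?_, fun t ht u hu htu => ?_⟩
  · have ht : t.card = 3 ∧ (∃ i ∈ t, ∃ j ∈ t, C.bad.Adj i j) ∧
        ∀ e ∈ t.powersetCard 2, 0 < C.sideRatio t e := by simpa [toSync] using ht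
    obtain ⟨h3, ⟨i, hi, j, hj, hij⟩, -⟩ := ht
    exact ⟨h3, fun h => (C.toSync.mem_clean.1 h).2 i hi j hj hij⟩
  · have hz : ∀ t c, (∀ e ∈ t.powersetCard 2, C.sideRatio t e = c * C.perimeter e) →
        ∑ e ∈ t.powersetCard 2, C.perimeter e = C.perimeter t → t ∈ C.toSync.clean →
        C.toSync.zstar t = -Real.log c := by
      intro t c h1 h2 h3
      have h4 := C.perimeter_pos hC (t := t) (by rw [(C.toSync.mem_clean.1 h3).1]; norm_num)
      change Real.log (C.perimeter t / ∑ e ∈ t.powersetCard 2, C.sideRatio t e) = _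
      rw [sum_congr rfl h1, ← mul_sum, h2, ← Real.log_inv]
      congr 1
      field_simp
    obtain ⟨c, hc, h1, h2⟩ := C.exists_sideRatio_eq hC ht
    obtain ⟨c', hc', h1', h2'⟩ := C.exists_sideRatio_eq hC hu
    rw [hz t c h1 h2 ht, hz u c' h1' h2' hu]
    have he : 0 < C.perimeter (t ∩ u) := C.perimeter_pos hC (le_of_eq (Eq.symm htu))
    change Real.log (C.sideRatio t (t ∩ u) / C.sideRatio u (t ∩ u)) = _
    rw [h1 _ (mem_powersetCard.2 ⟨inter_subset_left, htu⟩),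
      h1' _ (mem_powersetCard.2 ⟨inter_subset_right, htu⟩), mul_div_mul_right _ _ he.ne',
      Real.log_div hc.ne' hc'.ne']
    ring

end CameraData

end

end TriP

theorem mainTheorem6 :
    -- the constants of the four losses
    ((∀ a : ℝ, 0 < a → TriP.Loss.cauchy.lowerSlope a = 1 / (1 + a ^ 2)) ∧
      TriP.Loss.cauchy.maxScore = 1 / 2 ∧
      (∀ a : ℝ, 0 < a → TriP.Loss.welsch.lowerSlope a = Real.exp (-a ^ 2)) ∧
      TriP.Loss.welsch.maxScore = 1 / Real.sqrt (2 * Real.exp 1) ∧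
      (∀ a : ℝ, 0 < a → a < 1 → TriP.Loss.hardThreshold.lowerSlope a = 1) ∧
      TriP.Loss.hardThreshold.maxScore = 1 ∧
      (∀ a : ℝ, 0 < a → a < 1 → TriP.Loss.tukey.lowerSlope a = (1 - a ^ 2) ^ 2) ∧
      TriP.Loss.tukey.maxScore = 16 / (25 * Real.sqrt 5)) ∧
    -- `h_prof = 1 / 2` and the small-gain threshold with `C_J = 16`
    (∀ L : TriP.Loss,
      IsLUB (L.hProfAt '' Set.Ioi 0) (1 / 2) ∧ L.hProf = 1 / 2 ∧
      TriP.smallGainThreshold 16 L.hProf = 1 / 194) ∧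
    -- the window parameters that leave `1 / 200` as the binding condition exist, and for each of
    -- them the degree condition is sufficient
    (∀ L : TriP.Loss,
      (∃ a : ℝ, 0 < a ∧ 1 / 200 < TriP.smallGainThreshold 16 (L.hProfAt a)) ∧
      ∀ a : ℝ, 0 < a → 1 / 200 < TriP.smallGainThreshold 16 (L.hProfAt a) →
        ∃ N : ℕ, ∀ n : ℕ, N ≤ n →
          (∀ P : TriP.SyncProblem n, P.Valid →
            ((P.maxBadDegree : ℝ) / n < 1 / 200 → P.ProfiledRecovery L a 16) ∧
            ((P.maxBadDegree : ℝ) ≤ 1 / 1000 * n → P.ProfiledRecovery L a 16)) ∧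
          (∀ C : TriP.CameraData n, C.Valid →
            ((C.toSync.maxBadDegree : ℝ) / n < 1 / 200 → C.toSync.ProfiledRecovery L a 16) ∧
            ((C.toSync.maxBadDegree : ℝ) ≤ 1 / 1000 * n →
              C.toSync.ProfiledRecovery L a 16))) := by
  refine ⟨⟨fun a ha => TriP.Loss.cauchy.lowerSlope_eq ha, TriP.Loss.cauchy.maxScore_eq,
    fun a ha => TriP.Loss.welsch.lowerSlope_eq ha, TriP.Loss.welsch.maxScore_eq,
    fun a ha ha1 => ?_, TriP.Loss.hardThreshold.maxScore_eq, fun a ha ha1 => ?_,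
    TriP.Loss.tukey.maxScore_eq⟩, fun L => ⟨L.isLUB_hProfAt, L.hProf_eq, ?_⟩, fun L => ⟨?_, ?_⟩⟩
  · rw [TriP.Loss.lowerSlope_eq _ ha, TriP.Loss.weight, abs_of_pos ha, if_pos ha1]
  · rw [TriP.Loss.lowerSlope_eq _ ha, TriP.Loss.weight, max_eq_left (by nlinarith)]
  · rw [L.hProf_eq, TriP.smallGainThreshold]
    norm_num
  · obtain ⟨a, ha, h⟩ := L.exists_lt_hProfAt
    exact ⟨a, ha, (TriP.lt_smallGainThreshold_iff (L.hProfAt_nonneg ha)).2 h⟩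
  · intro a ha h
    rw [TriP.lt_smallGainThreshold_iff (L.hProfAt_nonneg ha)] at h
    obtain ⟨N, hN, hgain⟩ := TriP.SyncProblem.exists_smallGain h
    -- Stated for every valid problem, so the same `N` serves the camera problems.
    have key : ∀ n : ℕ, N ≤ n → ∀ P : TriP.SyncProblem n, P.Valid →
        ((P.maxBadDegree : ℝ) / n < 1 / 200 → P.ProfiledRecovery L a 16) ∧
        ((P.maxBadDegree : ℝ) ≤ 1 / 1000 * n → P.ProfiledRecovery L a 16) := by
      intro n hn P hP
      have hn1 := hN.trans hn
      have hn0 : (0 : ℝ) < n := by exact_mod_cast (by omega : 0 < n)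
      have hrec : (P.maxBadDegree : ℝ) ≤ n / 200 → P.ProfiledRecovery L a 16 := fun hΔ =>
        P.profiledRecovery hP ha (L.quarter_le_weight ha h) hn1 hΔ (hgain n hn P hP hΔ)
      refine ⟨fun hΔ => hrec ?_, fun hΔ => hrec (by linarith)⟩
      rw [div_lt_iff₀ hn0] at hΔ
      linarith
    exact ⟨N, fun n hn => ⟨key n hn, fun C hC => key n hn C.toSync (C.toSync_valid hC)⟩⟩
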